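/- Let $d \ge 3$. A \emph{grid curve} is a sequence of distinct points of $\mathbb{Z}^d$ in which any two consecutive points have Euclidean distance $1$ (they form an \emph{edge}; its \emph{axis} is the coordinate in which they differ). Consider a $d$-dimensional space-filling curve $f:[0,1]\to[0,1]^d$ described by approximating curves $A_0,A_1,A_2,\dots$ in the following sense. \begin{itemize} \item $A_k$ is a grid curve visiting exactly the points of $\{0,\dots,2^k-1\}^d$. \item $A_{k+1}$ is an \emph{inflation} of $A_k$: it is the concatenation of grid curves $C_{k,1},C_{k,2},\dots$, where $C_{k,i}$ visits exactly the points of $2v_{k,i}+\{0,1\}^d$ and $v_{k,i}$ is the $i$-th vertex of $A_k$ ($1\le i\le 2^{dk}$). \item $f$ maps $[(i-1)/2^{dk},\, i/2^{dk}]$ onto the cube $2^{-k}(v_{k,i}+[0,1]^d)$ for all $k$ and $i$. \end{itemize} An isometric image of a grid curve is its image under a signed permutation of the coordinates and a translation, possibly reversed. Let $G(d)$ be the grid curve of the binary reflected Gray code: $G(0)$ has no edges, and the edge directions of $G(n)$ are those of $G(n-1)$, then $+n$, then those of the reverse of $G(n-1)$ (order reversed and directions negated). \begin{itemize} \item A grid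 curve is \emph{well-folded} if it is a single vertex or an inflation of a well-folded curve in which every vertex is replaced by an isometric image of $G(d)$; $f$ is well-folded if all $A_k$ are. \item A grid curve is \emph{hyperorthogonal} if for every $n\in\{0,\dots,d-2\}$ any $2^n$ consecutive edges have exactly $n+1$ different axes; $f$ is hyperorthogonal if all $A_k$ are. \item $f$ is \emph{self-similar} if every $A_{k+1}$ is the concatenation of $2^d$ isometric images of $A_k$. \end{itemize} \textbf{Theorem.} If $f$ is self-similar, hyperorthogonal and well-folded, then, modulo reflection, rotation and reversal, its start point $f(0)$ is either $(0,\dots,0,0)$ or $(\frac13,\dots,\frac13,0)$. That is, there is a symmetry $g$ of the cube $[0,1]^d$ (a permutation of the coordinates composed with reflections $x_j\mapsto 1-x_j$) such that the curve $h(t)=g(f(t))$ or the curve $h(t)=g(f(1-t))$ has $h(0)\in\{(0,\dots,0,0),\,(\frac13,\dots,\frac13,0)\}$. -/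

import Mathlib

/-! ### Curves on the grid `ℤ^d` -/

/-- A vertex of the integer grid in `d` dimensions; axis `j + 1` is the coordinate `j : Fin d`. -/
abbrev GridPoint (d : ℕ) : Type := Fin d → ℤ

/-- `(v, w)` is an edge of the grid: the Euclidean distance of `v` and `w` is `1`. -/
def IsGridEdge {d : ℕ} (v w : GridPoint d) : Prop :=
  ∑ j, (w j - v j) ^ 2 = 1

/-- A (directed) curve on the grid, given by its vertices in order: a nonempty list of distinct
vertices, each two subsequent ones forming an edge. -/
def IsGridCurve {d : ℕ} (C : List (GridPoint d)) : Prop :=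
  C ≠ [] ∧ C.Nodup ∧ C.IsChain IsGridEdge

/-- `C` is a `k`-curve on the `k`-cube with minimal corner `c`: a Hamiltonian path on the
`(2 ^ k) ^ d` grid points of this cube. -/
def IsKCurveAt {d : ℕ} (k : ℕ) (c : GridPoint d) (C : List (GridPoint d)) : Prop :=
  IsGridCurve C ∧ ∀ v : GridPoint d, v ∈ C ↔ ∀ j, c j ≤ v j ∧ v j < c j + 2 ^ k

/-- The set of axes of the edges of a curve. -/
def axesOf {d : ℕ} (C : List (GridPoint d)) : Set (Fin d) :=
  {j | ∃ v w : GridPoint d, [v, w] <:+: C ∧ v j ≠ w j}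

/-- A curve is hyperorthogonal if, for every `n ∈ {0, …, d - 2}`, each sequence of `2 ^ n`
consecutive edges (that is, of `2 ^ n + 1` consecutive vertices) has exactly `n + 1` different
axes. -/
def IsHyperorthogonal {d : ℕ} (C : List (GridPoint d)) : Prop :=
  ∀ n : ℕ, n + 2 ≤ d → ∀ S : List (GridPoint d),
    S <:+: C → S.length = 2 ^ n + 1 → (axesOf S).ncard = n + 1

/-! ### Isometries of the grid -/

/-- A distance-preserving map of the grid: a signed permutation of the coordinates (an element of
the hyperoctahedral group) followed by a translation. -/
structure GridIsometry (d : ℕ) where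
  perm : Equiv.Perm (Fin d)
  sign : Fin d → ℤˣ
  shift : GridPoint d

/-- The action of an isometry on the vertices of the grid. -/
def GridIsometry.apply {d : ℕ} (g : GridIsometry d) (v : GridPoint d) : GridPoint d :=
  fun j => (g.sign j : ℤ) * v (g.perm j) + g.shift j

/-- `C'` is an isometric image of the curve `C`; taking the reverse is allowed. -/
def IsIsometricImage {d : ℕ} (C C' : List (GridPoint d)) : Prop :=
  ∃ g : GridIsometry d, C' = C.map g.apply ∨ C' = (C.map g.apply).reverse

/-! ### Gray codes, inflation and well-folded curves -/

/-- The free curve `G(n)` of the binary reflected Gray code as its list of edge directions, where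
a direction is an integer `±1, …, ±n`: `G(0)` is empty, and `G(n + 1)` is the concatenation of
`G(n)`, `⟨n + 1⟩` and the reverse of `G(n)`. -/
def grayCode : ℕ → List ℤ
  | 0 => []
  | n + 1 => grayCode n ++ [(n + 1 : ℤ)] ++ (grayCode n).reverse.map (fun i => -i)

/-- The unit step in direction `i ∈ {±1, …, ±d}`. -/
def dirStep {d : ℕ} (i : ℤ) : GridPoint d :=
  fun j => if i.natAbs = (j : ℕ) + 1 then i.sign else 0

/-- The curve `G(d)` with entry point `(0, …, 0)`. -/
def grayCurve (d : ℕ) : List (GridPoint d) :=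
  (grayCode d).scanl (fun v i => v + dirStep i) 0

/-- The curve `B` is obtained by inflating the curve `A`, replacing its vertices `v` in order by the
child curves `Cs`, where the child curve replacing `v` is a `1`-curve on the unit cube translated by
`2 v`. As `B` has to be a curve, the exit of each child curve is joined to the entry of the next one
by an edge, whose direction is necessarily that of the corresponding edge of `A`. -/
def IsInflation {d : ℕ} (A : List (GridPoint d)) (Cs : List (List (GridPoint d)))
    (B : List (GridPoint d)) : Prop :=
  List.Forall₂ (fun v C => IsKCurveAt 1 (2 • v) C) A Cs ∧ B = Cs.flatten ∧ IsGridCurve B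

/-- A curve is well-folded if it is a single vertex, or if it is obtained by inflating a well-folded
curve by replacing its vertices by isometric images of `G(d)`. -/
inductive IsWellFolded {d : ℕ} : List (GridPoint d) → Prop
  | single (v : GridPoint d) : IsWellFolded [v]
  | inflate (A : List (GridPoint d)) (Cs : List (List (GridPoint d))) (B : List (GridPoint d)) :
      IsWellFolded A → IsInflation A Cs B → (∀ C ∈ Cs, IsIsometricImage (grayCurve d) C) →
      IsWellFolded B

/-! ### Space-filling curves -/

/-- A `d`-dimensional space-filling curve `f : [0,1] → [0,1]^d` described by approximating curves
`A_0, A_1, …`: `A_k` is a `k`-curve on `{0, …, 2 ^ k - 1}^d`, the curve `A_{k+1}` is obtained from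
`A_k` by inflation, and, if `v` is the vertex of `A_k` with (zero-based) index `i`, then the section
of `f` over `[i / 2 ^ (d k), (i + 1) / 2 ^ (d k)]` fills exactly the cube of width `1 / 2 ^ k` with
minimal corner `v / 2 ^ k`. (The last condition makes `f` continuous and surjective, and `f` and
its approximating curves determine each other.) -/
structure SpaceFillingCurve (d : ℕ) where
  toFun : unitInterval → Fin d → unitInterval
  approx : ℕ → List (GridPoint d)
  isKCurve : ∀ k, IsKCurveAt k 0 (approx k)
  inflation : ∀ k, ∃ Cs, IsInflation (approx k) Cs (approx (k + 1))
  visits : ∀ (k i : ℕ) (v : GridPoint d), (approx k)[i]? = some v →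
    toFun '' {t | (i : ℝ) / 2 ^ (d * k) ≤ (t : ℝ) ∧ (t : ℝ) ≤ ((i : ℝ) + 1) / 2 ^ (d * k)} =
      {x | ∀ j, (v j : ℝ) / 2 ^ k ≤ (x j : ℝ) ∧ (x j : ℝ) ≤ ((v j : ℝ) + 1) / 2 ^ k}

/-- A space-filling curve is well-folded if its approximating curves are. -/
def SpaceFillingCurve.WellFolded {d : ℕ} (f : SpaceFillingCurve d) : Prop :=
  ∀ k, IsWellFolded (f.approx k)

/-- A space-filling curve is hyperorthogonal if its approximating curves are. -/
def SpaceFillingCurve.Hyperorthogonal {d : ℕ} (f : SpaceFillingCurve d) : Prop :=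
  ∀ k, IsHyperorthogonal (f.approx k)

/-- A space-filling curve is self-similar if each approximating curve `A_{k+1}` is the concatenation
of `2 ^ d` isometric (possibly reversed) copies of `A_k`. -/
def SpaceFillingCurve.SelfSimilar {d : ℕ} (f : SpaceFillingCurve d) : Prop :=
  ∀ k, ∃ Bs : List (List (GridPoint d)), Bs.length = 2 ^ d ∧
    (∀ B ∈ Bs, IsIsometricImage (f.approx k) B) ∧ f.approx (k + 1) = Bs.flatten

/-! ### Reflections, rotations and reversal of space-filling curves -/

/-- A symmetry of the cube `[0,1]^d` (a composition of reflections and rotations): a permutation of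
the coordinates followed by the reflections `x ↦ 1 - x` in a set of coordinates. -/
structure CubeSymmetry (d : ℕ) where
  perm : Equiv.Perm (Fin d)
  flip : Fin d → Bool

/-- The action of a symmetry on the points of the unit cube. -/
def CubeSymmetry.apply {d : ℕ} (g : CubeSymmetry d) (x : Fin d → unitInterval) :
    Fin d → unitInterval :=
  fun j => if g.flip j then unitInterval.symm (x (g.perm j)) else x (g.perm j)

/-- `h` equals `f` modulo reflection, rotation and reversal. -/
def EqualModuloIsometry {d : ℕ} (f h : unitInterval → Fin d → unitInterval) : Prop :=
  ∃ g : CubeSymmetry d,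
    (∀ t, h t = g.apply (f t)) ∨ (∀ t, h t = g.apply (f (unitInterval.symm t)))

/-! The binary digits of f(0) are read off the first vertices of the A_k, so the question is, for
each level and coordinate, whether the two lowest digits of the first vertex agree (`digitDiff`).
These bits, one per axis, form a state. From level 2 on, a copy of a curve sits at an offset
divisible by 4, possibly with both digits complemented, so self-similarity merely permutes the bits
among the axes. Along a curve, an edge inside a Gray code flips the bit of its axis, while an edge
joining two Gray codes flips both digits and changes nothing.

Hyperorthogonality forces a joining edge to use one of the last two axes of the Gray codes on either
side. Hence the last two axes at an inner vertex are those of the edges entering and leaving it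
(`last_pair`). A Gray code is entered and left in states differing only on its last axis, and the
bit on the axis of a joining edge is known in advance. Together these facts decide which of the two
axes is last, and show that all odd-numbered Gray codes of a block are entered in one state
(`entryState_odd`). Up to renaming axes, this state is the same for all blocks of A_3 (`transport`).

The state at a gate, the entry of an inner block of A_3, can be computed from the block after it and
from the block before it (`gate_next`, `gate_prev`). Let z and w be the values of the common state
on the last two axes of A_1. Comparing both computations gives z = w: for d ≥ 4 the value on the
third last axis is both z ∨ w and z ∧ w (`third_last`), and d = 3 is settled by inspecting the first
gate. If z and w are false, all bits at all gates are false. If they are true, all bits are true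
except on the axis of the edge through the gate. Block 1 of A_3 is a copy of A_2 with both ends at
gates, so the ends of A_2, and by self-similarity those of all later curves, obey the same
alternative (`digitDiff_first`).

In the first case every coordinate of f(0) has constant digits and is 0 or 1. In the second case, at
each level, all axes but one have differing digits. The exceptional axis is the same at all levels
because the first vertex lies on a face of its cube (`exists_face`). So the other coordinates have
alternating digits and are 1/3 or 2/3, and a symmetry of the cube finishes. -/

/-- Flip the value of a Boolean state at one coordinate. -/
def flipAt {d : ℕ} (X : Fin d → Bool) (c : Fin d) : Fin d → Bool :=
  Function.update X c (!X c)

lemma flipAt_self {d : ℕ} (X : Fin d → Bool) (c : Fin d) : flipAt X c c = !X c := by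
  simp [flipAt]

lemma flipAt_of_ne {d : ℕ} (X : Fin d → Bool) {c j : Fin d} (h : j ≠ c) :
    flipAt X c j = X j := by
  simp [flipAt, h]

lemma flipAt_apply {d : ℕ} (X : Fin d → Bool) (c j : Fin d) :
    flipAt X c j = if j = c then !X j else X j := by
  by_cases h : j = c
  · subst h; simp [flipAt_self]
  · simp [flipAt_of_ne X h, h]

lemma flipAt_flipAt {d : ℕ} (X : Fin d → Bool) (c : Fin d) : flipAt (flipAt X c) c = X := by
  funext j
  by_cases h : j = c <;> simp [flipAt_apply, h]

lemma flipAt_comm {d : ℕ} (X : Fin d → Bool) (a b : Fin d) :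
    flipAt (flipAt X a) b = flipAt (flipAt X b) a := by
  funext j
  simp only [flipAt_apply]
  split_ifs <;> rfl

/-! ### Edge indices as a power of two times an odd number. -/

lemma exists_two_pow_mul_odd {d m : ℕ} (h0 : 0 < m) (hm : m < 2 ^ d) :
    ∃ n q, n < d ∧ m = 2 ^ n * (2 * q + 1) := by
  obtain ⟨n, r, ⟨q, rfl⟩, h⟩ := Nat.exists_eq_two_pow_mul_odd h0.ne'
  refine ⟨n, q, ?_, h⟩
  by_contra hn
  have h1 : 2 ^ d ≤ 2 ^ n := Nat.pow_le_pow_right (by norm_num) (by omega)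
  have h2 : 2 ^ n * 1 ≤ 2 ^ n * (2 * q + 1) := Nat.mul_le_mul_left _ (by omega)
  omega

lemma two_pow_sub_two_pow_mul_odd {d n q : ℕ} (hn : n < d) (h : 2 ^ n * (2 * q + 1) < 2 ^ d) :
    ∃ q', 2 ^ d - 2 ^ n * (2 * q + 1) = 2 ^ n * (2 * q' + 1) := by
  obtain ⟨r, rfl⟩ := Nat.exists_eq_add_of_lt hn
  have e : 2 ^ (n + r + 1) = 2 ^ n * (2 * 2 ^ r) := by ring
  rw [e] at h ⊢
  have h' := Nat.lt_of_mul_lt_mul_left h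
  refine ⟨2 ^ r - q - 1, ?_⟩
  rw [← Nat.mul_sub]
  congr 1
  omega

/-! ### The abstract system of vertices and edge axes. -/

/-- The combinatorial data of the approximating curves of a self-similar hyperorthogonal
well-folded curve: `V k i` is the vertex with index `i` of the `k`-th curve, and `ax k m` is the
axis of its edge from `V k (m - 1)` to `V k m`. -/
structure FoldedSystem (d : ℕ) (V : ℕ → ℕ → GridPoint d) (ax : ℕ → ℕ → Fin d) : Prop where
  step_ax : ∀ k m, 0 < m → m < (2 ^ d) ^ k →
    V k m (ax k m) = V k (m - 1) (ax k m) + 1 ∨ V k m (ax k m) = V k (m - 1) (ax k m) - 1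
  step_ne : ∀ k m j, 0 < m → m < (2 ^ d) ^ k → j ≠ ax k m → V k m j = V k (m - 1) j
  parent : ∀ k i m j, i < (2 ^ d) ^ k → m < 2 ^ d → V (k + 1) (i * 2 ^ d + m) j / 2 = V k i j
  ruler : ∀ k i n q, i < (2 ^ d) ^ k → 2 ^ n * (2 * q + 1) < 2 ^ d →
    ax (k + 1) (i * 2 ^ d + 2 ^ n * (2 * q + 1)) = ax (k + 1) (i * 2 ^ d + 2 ^ n)
  ruler_inj : ∀ k i n n', i < (2 ^ d) ^ k → n < d → n' < d →
    ax (k + 1) (i * 2 ^ d + 2 ^ n) = ax (k + 1) (i * 2 ^ d + 2 ^ n') → n = n'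
  hyper : ∀ k n s, n + 2 ≤ d → s + 2 ^ n < (2 ^ d) ^ k →
    ((Finset.Ioc s (s + 2 ^ n)).image (ax k)).card = n + 1
  similar : ∀ k t, t < 2 ^ d → ∃ (π : Equiv.Perm (Fin d)) (ρ : ℕ → ℕ),
    ((∀ m, ρ m = m) ∨ ∀ m, ρ m = (2 ^ d) ^ k - 1 - m) ∧
    ∀ j, ∃ w : ℤ,
      (∀ m < (2 ^ d) ^ k, V (k + 1) (t * (2 ^ d) ^ k + m) (π j) = 2 ^ k * w + V k (ρ m) j) ∨
      (∀ m < (2 ^ d) ^ k,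
        V (k + 1) (t * (2 ^ d) ^ k + m) (π j) = 2 ^ k * w + (2 ^ k - 1 - V k (ρ m) j))

namespace FoldedSystem

variable {d : ℕ} {V : ℕ → ℕ → GridPoint d} {ax : ℕ → ℕ → Fin d}

/-- Whether the two lowest binary digits of the coordinates of a vertex differ. -/
def digitDiff (V : ℕ → ℕ → GridPoint d) (k i : ℕ) (j : Fin d) : Bool :=
  decide (V k i j % 4 = 1 ∨ V k i j % 4 = 2)

/-- The axis `n` of the Gray code replacing the vertex `i` of the `k`-th curve. -/
def pos (ax : ℕ → ℕ → Fin d) (k i n : ℕ) : Fin d := ax (k + 1) (i * 2 ^ d + 2 ^ n)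

lemma mul_add_lt {k i m N : ℕ} (hi : i < N ^ k) (hm : m < N) : i * N + m < N ^ (k + 1) := by
  calc i * N + m < i * N + N := by omega
    _ = (i + 1) * N := by ring
    _ ≤ N ^ k * N := Nat.mul_le_mul_right _ hi
    _ = N ^ (k + 1) := by ring

lemma pred_mul_add {i N : ℕ} (hi : 0 < i) (m : ℕ) (hm : m ≤ N) :
    i * N - m = (i - 1) * N + (N - m) := by
  obtain ⟨i, rfl⟩ := Nat.exists_eq_add_of_lt hi
  simp only [zero_add, Nat.add_sub_cancel, add_mul, one_mul]
  omega

lemma eq_ax (hS : FoldedSystem d V ax) {k m : ℕ} {j : Fin d} (h0 : 0 < m)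
    (hm : m < (2 ^ d) ^ k) (h : V k m j ≠ V k (m - 1) j) : ax k m = j := by
  by_contra hne
  exact h (hS.step_ne k m j h0 hm (Ne.symm hne))

lemma ax_changes (hS : FoldedSystem d V ax) {k m : ℕ} (h0 : 0 < m)
    (hm : m < (2 ^ d) ^ k) : V k m (ax k m) ≠ V k (m - 1) (ax k m) := by
  rcases hS.step_ax k m h0 hm with h | h <;> omega

lemma parent_zero (hS : FoldedSystem d V ax) {k i : ℕ} (j : Fin d) (hi : i < (2 ^ d) ^ k) :
    V (k + 1) (i * 2 ^ d) j / 2 = V k i j := by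
  simpa using hS.parent k i 0 j hi (by positivity)

lemma parent_pred (hS : FoldedSystem d V ax) {k i : ℕ} (j : Fin d) (h0 : 0 < i)
    (hi : i < (2 ^ d) ^ k) : V (k + 1) (i * 2 ^ d - 1) j / 2 = V k (i - 1) j := by
  have hN : 0 < 2 ^ d := by positivity
  rw [pred_mul_add h0 1 hN]
  exact hS.parent k (i - 1) _ j (by omega) (by omega)

lemma mul_lt {k i : ℕ} (hi : i < (2 ^ d) ^ k) : i * 2 ^ d < (2 ^ d) ^ (k + 1) := by
  simpa using mul_add_lt (m := 0) hi (by positivity)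

lemma ax_mul (hS : FoldedSystem d V ax) {k i : ℕ} (h0 : 0 < i) (hi : i < (2 ^ d) ^ k) :
    ax (k + 1) (i * 2 ^ d) = ax k i := by
  refine hS.eq_ax (by positivity) (mul_lt hi) fun h => hS.ax_changes h0 hi ?_
  rw [← hS.parent_zero _ hi, ← hS.parent_pred _ h0 hi, h]

lemma pos_surj (hS : FoldedSystem d V ax) {k i : ℕ} (hi : i < (2 ^ d) ^ k) (j : Fin d) :
    ∃ n < d, pos ax k i n = j := by
  have hinj : Function.Injective fun n : Fin d => pos ax k i n := fun a b h =>
    Fin.ext (hS.ruler_inj k i a b hi a.2 b.2 h)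
  obtain ⟨n, hn⟩ := (Finite.injective_iff_surjective.1 hinj) j
  exact ⟨n, n.2, hn⟩

lemma pos_ne (hS : FoldedSystem d V ax) {k i n n' : ℕ} (hi : i < (2 ^ d) ^ k) (hn : n < d)
    (hn' : n' < d) (h : n ≠ n') : pos ax k i n ≠ pos ax k i n' :=
  fun e => h (hS.ruler_inj k i n n' hi hn hn' e)

lemma ax_eq_pos (hS : FoldedSystem d V ax) {k i n q : ℕ} (hi : i < (2 ^ d) ^ k)
    (h : 2 ^ n * (2 * q + 1) < 2 ^ d) :
    ax (k + 1) (i * 2 ^ d + 2 ^ n * (2 * q + 1)) = pos ax k i n :=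
  hS.ruler k i n q hi h

lemma ax_sub_eq_pos (hS : FoldedSystem d V ax) {k i n q : ℕ} (h0 : 0 < i)
    (hi : i ≤ (2 ^ d) ^ k) (hn : n < d) (h : 2 ^ n * (2 * q + 1) < 2 ^ d) :
    ax (k + 1) (i * 2 ^ d - 2 ^ n * (2 * q + 1)) = pos ax k (i - 1) n := by
  obtain ⟨q', hq'⟩ := two_pow_sub_two_pow_mul_odd hn h
  rw [pred_mul_add h0 _ h.le, hq']
  refine hS.ax_eq_pos (by omega) ?_
  rw [← hq']
  have : 0 < 2 ^ n * (2 * q + 1) := by positivity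
  omega

/-! ### Hyperorthogonality at the joints between Gray codes. -/

/-- The 2^(d-2) edges starting with the joining edge must have d - 1 axes. All but the joining edge
only use the first d - 2 axes of the Gray code, so the joining edge has to supply a new one. -/
lemma ax_ne_pos (hS : FoldedSystem d V ax) (hd : 3 ≤ d) {k i n : ℕ} (h0 : 0 < i)
    (hi : i < (2 ^ d) ^ k) (hn : n < d - 2) : ax k i ≠ pos ax k i n := by
  intro he
  have hN : 2 ^ (d - 2) < 2 ^ d := Nat.pow_lt_pow_right (by norm_num) (by omega)
  have hpos : 0 < i * 2 ^ d := by positivity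
  have h1 : 0 < 2 ^ (d - 2) := by positivity
  have hb := mul_add_lt hi (show 2 ^ (d - 2) - 1 < 2 ^ d by omega)
  -- `Finset.Ioc` omits its left end, so this window begins exactly with the joining edge, of index
  -- `i * 2 ^ d`.
  have hc := hS.hyper (k + 1) (d - 2) (i * 2 ^ d - 1) (by omega) (by omega)
  have hsub : (Finset.Ioc (i * 2 ^ d - 1) (i * 2 ^ d - 1 + 2 ^ (d - 2))).image (ax (k + 1)) ⊆
      (Finset.range (d - 2)).image (pos ax k i) := by
    intro j hj
    obtain ⟨m, hm, rfl⟩ := Finset.mem_image.1 hj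
    rw [Finset.mem_Ioc] at hm
    obtain ⟨r, rfl⟩ := Nat.exists_eq_add_of_le (show i * 2 ^ d ≤ m by omega)
    rw [Finset.mem_image]
    rcases Nat.eq_zero_or_pos r with rfl | hr
    · exact ⟨n, Finset.mem_range.2 hn, by rw [add_zero, hS.ax_mul h0 hi, he]⟩
    · obtain ⟨n', q, hn', rfl⟩ := exists_two_pow_mul_odd hr (show r < 2 ^ (d - 2) by omega)
      exact ⟨n', Finset.mem_range.2 hn', (hS.ax_eq_pos hi (by omega)).symm⟩
  have := (Finset.card_le_card hsub).trans Finset.card_image_le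
  rw [Finset.card_range] at this
  omega

lemma ax_ne_pos_pred (hS : FoldedSystem d V ax) (hd : 3 ≤ d) {k i n : ℕ} (h0 : 0 < i)
    (hi : i < (2 ^ d) ^ k) (hn : n < d - 2) : ax k i ≠ pos ax k (i - 1) n := by
  intro he
  have hN : 2 ^ (d - 2) < 2 ^ d := Nat.pow_lt_pow_right (by norm_num) (by omega)
  have hle : 2 ^ d ≤ i * 2 ^ d := Nat.le_mul_of_pos_left _ h0
  have h1 : 0 < 2 ^ (d - 2) := by positivity
  have hb := mul_lt hi
  have hc := hS.hyper (k + 1) (d - 2) (i * 2 ^ d - 2 ^ (d - 2)) (by omega) (by omega)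
  have hsub : (Finset.Ioc (i * 2 ^ d - 2 ^ (d - 2))
      (i * 2 ^ d - 2 ^ (d - 2) + 2 ^ (d - 2))).image (ax (k + 1)) ⊆
      (Finset.range (d - 2)).image (pos ax k (i - 1)) := by
    intro j hj
    obtain ⟨m, hm, rfl⟩ := Finset.mem_image.1 hj
    rw [Finset.mem_Ioc] at hm
    obtain ⟨r, hr⟩ := Nat.exists_eq_add_of_le (show m ≤ i * 2 ^ d by omega)
    obtain rfl : m = i * 2 ^ d - r := by omega
    rw [Finset.mem_image]
    rcases Nat.eq_zero_or_pos r with rfl | hr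
    · exact ⟨n, Finset.mem_range.2 hn, by rw [Nat.sub_zero, hS.ax_mul h0 hi, he]⟩
    · obtain ⟨n', q, hn', rfl⟩ := exists_two_pow_mul_odd hr (show r < 2 ^ (d - 2) by omega)
      exact ⟨n', Finset.mem_range.2 hn',
        (hS.ax_sub_eq_pos h0 hi.le (by omega) (by omega)).symm⟩
  have := (Finset.card_le_card hsub).trans Finset.card_image_le
  rw [Finset.card_range] at this
  omega

lemma ax_mem (hS : FoldedSystem d V ax) (hd : 3 ≤ d) {k i : ℕ} (h0 : 0 < i)
    (hi : i < (2 ^ d) ^ k) : ax k i = pos ax k i (d - 2) ∨ ax k i = pos ax k i (d - 1) := by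
  obtain ⟨n, hn, h⟩ := hS.pos_surj hi (ax k i)
  by_cases h2 : n < d - 2
  · exact absurd h.symm (hS.ax_ne_pos hd h0 hi h2)
  · obtain rfl | rfl : n = d - 2 ∨ n = d - 1 := by omega
    exacts [Or.inl h.symm, Or.inr h.symm]

lemma ax_mem_pred (hS : FoldedSystem d V ax) (hd : 3 ≤ d) {k i : ℕ} (h0 : 0 < i)
    (hi : i < (2 ^ d) ^ k) :
    ax k i = pos ax k (i - 1) (d - 2) ∨ ax k i = pos ax k (i - 1) (d - 1) := by
  obtain ⟨n, hn, h⟩ := hS.pos_surj (show i - 1 < (2 ^ d) ^ k by omega) (ax k i)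
  by_cases h2 : n < d - 2
  · exact absurd h.symm (hS.ax_ne_pos_pred hd h0 hi h2)
  · obtain rfl | rfl : n = d - 2 ∨ n = d - 1 := by omega
    exacts [Or.inl h.symm, Or.inr h.symm]

/-- The first axes of a Gray code occur in front of the last one in the next Gray code. -/
lemma pos_pred_mem (hS : FoldedSystem d V ax) (hd : 3 ≤ d) {k i n : ℕ} (h0 : 0 < i)
    (hi : i < (2 ^ d) ^ k) (hn : n < d - 3) :
    pos ax k (i - 1) n = ax k i ∨ ∃ m < d - 2, pos ax k (i - 1) n = pos ax k i m := by
  have hN : 2 ^ (d - 2) < 2 ^ d := Nat.pow_lt_pow_right (by norm_num) (by omega)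
  have hN' : 2 ^ (d - 2) = 2 * 2 ^ (d - 3) := by
    rw [← pow_succ']; congr 1; omega
  have hle : 2 ^ d ≤ i * 2 ^ d := Nat.le_mul_of_pos_left _ h0
  have h1 : 0 < 2 ^ (d - 3) := by positivity
  have hb := mul_add_lt hi (show 2 ^ (d - 3) < 2 ^ d by omega)
  -- This window straddles the joint. Its right half and the joining edge already show d - 1 axes,
  -- so the left half adds none.
  have hc := hS.hyper (k + 1) (d - 2) (i * 2 ^ d - 2 ^ (d - 3)) (by omega) (by omega)
  have hsub : insert (ax k i) ((Finset.range (d - 2)).image (pos ax k i)) ⊆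
      (Finset.Ioc (i * 2 ^ d - 2 ^ (d - 3))
      (i * 2 ^ d - 2 ^ (d - 3) + 2 ^ (d - 2))).image (ax (k + 1)) := by
    intro j hj
    rw [Finset.mem_insert, Finset.mem_image] at hj
    rw [Finset.mem_image]
    rcases hj with rfl | ⟨m, hm, rfl⟩
    · exact ⟨i * 2 ^ d, Finset.mem_Ioc.2 ⟨by omega, by omega⟩, hS.ax_mul h0 hi⟩
    · have : 2 ^ m ≤ 2 ^ (d - 3) :=
        Nat.pow_le_pow_right (by norm_num) (by have := Finset.mem_range.1 hm; omega)
      have : 0 < 2 ^ m := by positivity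
      exact ⟨i * 2 ^ d + 2 ^ m, Finset.mem_Ioc.2 ⟨by omega, by omega⟩, rfl⟩
  have hcard : (insert (ax k i) ((Finset.range (d - 2)).image (pos ax k i))).card = d - 1 := by
    rw [Finset.card_insert_of_notMem, Finset.card_image_of_injOn, Finset.card_range]
    · omega
    · intro a ha b hb h
      simp only [Finset.coe_range, Set.mem_Iio] at ha hb
      exact hS.ruler_inj k i a b hi (by omega) (by omega) h
    · rw [Finset.mem_image]
      rintro ⟨m, hm, h⟩
      exact hS.ax_ne_pos hd h0 hi (Finset.mem_range.1 hm) h.symm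
  have heq := Finset.eq_of_subset_of_card_le hsub (by omega)
  have hn0 : 0 < 2 ^ n := by positivity
  have h3 : 2 ^ n < 2 ^ (d - 3) := Nat.pow_lt_pow_right (by norm_num) hn
  have hmem : pos ax k (i - 1) n ∈ (Finset.Ioc (i * 2 ^ d - 2 ^ (d - 3))
      (i * 2 ^ d - 2 ^ (d - 3) + 2 ^ (d - 2))).image (ax (k + 1)) := by
    rw [Finset.mem_image]
    refine ⟨i * 2 ^ d - 2 ^ n, Finset.mem_Ioc.2 ⟨by omega, by omega⟩, ?_⟩
    simpa using hS.ax_sub_eq_pos (q := 0) h0 hi.le (show n < d by omega) (by omega)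
  rw [← heq, Finset.mem_insert, Finset.mem_image] at hmem
  rcases hmem with h | ⟨m, hm, h⟩
  · exact Or.inl h
  · exact Or.inr ⟨m, Finset.mem_range.1 hm, h.symm⟩

/-! ### How the two lowest digits change along a curve. -/

lemma digitDiff_step (hS : FoldedSystem d V ax) {k i m : ℕ} (hi : i < (2 ^ d) ^ k)
    (h0 : 0 < m) (hm : m < 2 ^ d) :
    digitDiff V (k + 1) (i * 2 ^ d + m) =
      flipAt (digitDiff V (k + 1) (i * 2 ^ d + m - 1)) (ax (k + 1) (i * 2 ^ d + m)) := by
  have hlt := mul_add_lt hi hm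
  funext j
  by_cases hj : j = ax (k + 1) (i * 2 ^ d + m)
  · have h1 := hS.ax_changes (by omega) hlt
    have h2 := hS.parent k i m j hi hm
    have h3 := hS.parent k i (m - 1) j hi (by omega)
    rw [show i * 2 ^ d + (m - 1) = i * 2 ^ d + m - 1 by omega] at h3
    rw [← hj] at h1 ⊢
    rw [flipAt_self]
    unfold digitDiff
    rw [← decide_not, decide_eq_decide]
    omega
  · rw [flipAt_of_ne _ hj]
    unfold digitDiff
    rw [hS.step_ne _ _ j (by omega) hlt hj]

/-- The step changes the parent as well, so on its axis the carry flips both low digits. -/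
lemma digitDiff_cross (hS : FoldedSystem d V ax) {k i : ℕ} (h0 : 0 < i) (hi : i < (2 ^ d) ^ k) :
    digitDiff V (k + 1) (i * 2 ^ d) = digitDiff V (k + 1) (i * 2 ^ d - 1) := by
  funext j
  by_cases hj : j = ax (k + 1) (i * 2 ^ d)
  · have h1 := hS.step_ax (k + 1) (i * 2 ^ d) (by positivity) (mul_lt hi)
    have h2 := hS.parent_zero j hi
    have h3 := hS.parent_pred j h0 hi
    have h4 := hS.ax_changes h0 hi
    rw [← hS.ax_mul h0 hi] at h4
    rw [← hj] at h1 h4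
    unfold digitDiff
    rw [decide_eq_decide]
    omega
  · unfold digitDiff
    rw [hS.step_ne _ _ j (by positivity) (mul_lt hi) hj]

/-- The parents lie in one common block, so the step on this axis is between residues 1 and 2 modulo
4. -/
lemma digitDiff_inside (hS : FoldedSystem d V ax) {k u r : ℕ} (hu : u < (2 ^ d) ^ k)
    (h0 : 0 < r) (hr : r < 2 ^ d) :
    digitDiff V (k + 2) ((u * 2 ^ d + r) * 2 ^ d) (ax (k + 1) (u * 2 ^ d + r)) = true := by
  have hi := mul_add_lt hu hr
  have hi0 : 0 < u * 2 ^ d + r := by omega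
  set j := ax (k + 1) (u * 2 ^ d + r) with hj
  have h1 := hS.step_ax (k + 2) ((u * 2 ^ d + r) * 2 ^ d) (by positivity) (mul_lt hi)
  rw [hS.ax_mul hi0 hi, ← hj] at h1
  have h2 := hS.parent_zero j hi
  have h3 := hS.parent_pred j hi0 hi
  have h4 := hS.ax_changes hi0 hi
  rw [← hj] at h4
  have h5 := hS.parent k u r j hu hr
  have h6 := hS.parent k u (r - 1) j hu (by omega)
  rw [show u * 2 ^ d + (r - 1) = u * 2 ^ d + r - 1 by omega] at h6
  unfold digitDiff
  rw [decide_eq_true_eq]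
  simp only [add_assoc, Nat.reduceAdd] at *
  omega

/-- Here the grandparents differ too, so the step on this axis is between residues 3 and 0 modulo 4.
-/
lemma digitDiff_outside (hS : FoldedSystem d V ax) {k u : ℕ} (h0 : 0 < u)
    (hu : u < (2 ^ d) ^ k) :
    digitDiff V (k + 2) (u * 2 ^ d * 2 ^ d) (ax k u) = false := by
  have hi := mul_lt hu
  have hi0 : 0 < u * 2 ^ d := by positivity
  set j := ax k u with hj
  have h1 := hS.step_ax (k + 2) (u * 2 ^ d * 2 ^ d) (by positivity) (mul_lt hi)
  rw [hS.ax_mul hi0 hi, hS.ax_mul h0 hu, ← hj] at h1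
  have h2 := hS.parent_zero j hi
  have h3 := hS.parent_pred j hi0 hi
  have h4 := hS.ax_changes h0 hu
  rw [← hj] at h4
  have h5 := hS.parent_zero j hu
  have h6 := hS.parent_pred j h0 hu
  unfold digitDiff
  rw [decide_eq_false_iff_not]
  simp only [add_assoc, Nat.reduceAdd] at *
  omega

/-- An aligned run of 2^(n+1) vertices consists of two shorter runs joined by an edge on axis n.
Both shorter runs have the same net effect, so these cancel. -/
lemma digitDiff_subcube (hS : FoldedSystem d V ax) {k i : ℕ} (hi : i < (2 ^ d) ^ k) (n : ℕ) :
    ∀ q, (q + 1) * 2 ^ (n + 1) ≤ 2 ^ d →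
      digitDiff V (k + 1) (i * 2 ^ d + (q * 2 ^ (n + 1) + (2 ^ (n + 1) - 1))) =
        flipAt (digitDiff V (k + 1) (i * 2 ^ d + q * 2 ^ (n + 1))) (pos ax k i n) := by
  induction n with
  | zero =>
    intro q hq
    have h := hS.digitDiff_step hi (show 0 < q * 2 + 1 by omega) (by omega)
    have e := hS.ax_eq_pos (n := 0) (q := q) hi (by omega)
    rw [show 2 ^ 0 * (2 * q + 1) = q * 2 + 1 by ring] at e
    rw [e] at h
    simpa [← add_assoc] using h
  | succ n ih =>
    intro q hq
    have hp : 0 < 2 ^ (n + 1) := by positivity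
    have e2 : 2 ^ (n + 1 + 1) = 2 * 2 ^ (n + 1) := by ring
    have e3 : (2 * q + 1 + 1) * 2 ^ (n + 1) = (q + 1) * 2 ^ (n + 1 + 1) := by ring
    have e4 : (2 * q + 1) * 2 ^ (n + 1) = q * 2 ^ (n + 1 + 1) + 2 ^ (n + 1) := by ring
    have e5 : 2 * q * 2 ^ (n + 1) = q * 2 ^ (n + 1 + 1) := by ring
    have e6 : (q + 1) * 2 ^ (n + 1 + 1) = q * 2 ^ (n + 1 + 1) + 2 ^ (n + 1 + 1) := by ring
    have h1 := ih (2 * q) (by omega)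
    have h2 := ih (2 * q + 1) (by omega)
    have h3 := hS.digitDiff_step hi (show 0 < (2 * q + 1) * 2 ^ (n + 1) by positivity) (by omega)
    have e := hS.ax_eq_pos (n := n + 1) (q := q) hi (by rw [mul_comm]; omega)
    rw [mul_comm (2 ^ (n + 1))] at e
    rw [e] at h3
    rw [show i * 2 ^ d + (q * 2 ^ (n + 1 + 1) + (2 ^ (n + 1 + 1) - 1)) =
      i * 2 ^ d + ((2 * q + 1) * 2 ^ (n + 1) + (2 ^ (n + 1) - 1)) by omega, h2, h3,
      show i * 2 ^ d + (2 * q + 1) * 2 ^ (n + 1) - 1 =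
      i * 2 ^ d + (2 * q * 2 ^ (n + 1) + (2 ^ (n + 1) - 1)) by omega, h1, flipAt_comm,
      flipAt_flipAt, e5]

lemma digitDiff_exit (hS : FoldedSystem d V ax) (hd : 0 < d) {k i : ℕ} (hi : i < (2 ^ d) ^ k) :
    digitDiff V (k + 1) ((i + 1) * 2 ^ d - 1) =
      flipAt (digitDiff V (k + 1) (i * 2 ^ d)) (pos ax k i (d - 1)) := by
  obtain ⟨n, rfl⟩ := Nat.exists_eq_add_of_lt hd
  have h := hS.digitDiff_subcube hi n 0 (by simp)
  simp only [zero_mul, zero_add, add_zero] at h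
  simp only [zero_add, Nat.add_sub_cancel]
  rw [← h]
  congr 1
  rw [add_mul, one_mul]
  have : 0 < 2 ^ (n + 1) := by positivity
  omega

lemma digitDiff_next (hS : FoldedSystem d V ax) (hd : 0 < d) {k i : ℕ}
    (hi : i + 1 < (2 ^ d) ^ k) :
    digitDiff V (k + 1) ((i + 1) * 2 ^ d) =
      flipAt (digitDiff V (k + 1) (i * 2 ^ d)) (pos ax k i (d - 1)) := by
  rw [hS.digitDiff_cross (by omega) hi, hS.digitDiff_exit hd (by omega)]

end FoldedSystem

/-! ### Entry states of the Gray codes within a block. -/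

namespace FoldedSystem

variable {d : ℕ} {V : ℕ → ℕ → GridPoint d} {ax : ℕ → ℕ → Fin d}

lemma ax_ne_succ (hS : FoldedSystem d V ax) (hd : 3 ≤ d) {k i : ℕ} (h0 : 0 < i)
    (hi : i + 1 < (2 ^ d) ^ k) : ax k i ≠ ax k (i + 1) := by
  intro he
  have hc := hS.hyper k 1 (i - 1) (by omega) (by omega)
  have hsub : (Finset.Ioc (i - 1) (i - 1 + 2 ^ 1)).image (ax k) ⊆ {ax k i} := by
    intro j hj
    obtain ⟨m, hm, rfl⟩ := Finset.mem_image.1 hj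
    rw [Finset.mem_Ioc] at hm
    rw [Finset.mem_singleton]
    obtain rfl | rfl : m = i ∨ m = i + 1 := by omega
    exacts [rfl, he.symm]
  have := Finset.card_le_card hsub
  rw [Finset.card_singleton] at this
  omega

lemma last_pair (hS : FoldedSystem d V ax) (hd : 3 ≤ d) {k i : ℕ} (h0 : 0 < i)
    (hi : i + 1 < (2 ^ d) ^ k) :
    (pos ax k i (d - 2) = ax k i ∧ pos ax k i (d - 1) = ax k (i + 1)) ∨
    (pos ax k i (d - 2) = ax k (i + 1) ∧ pos ax k i (d - 1) = ax k i) := by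
  have h1 := hS.ax_mem hd h0 (show i < (2 ^ d) ^ k by omega)
  have h2 := hS.ax_mem_pred hd (Nat.succ_pos i) hi
  have h3 := hS.ax_ne_succ hd h0 hi
  simp only [Nat.succ_eq_add_one, Nat.add_sub_cancel] at h2
  rcases h1 with h1 | h1 <;> rcases h2 with h2 | h2
  · exact absurd (h1.trans h2.symm) h3
  · exact Or.inl ⟨h1.symm, h2.symm⟩
  · exact Or.inr ⟨h2.symm, h1.symm⟩
  · exact absurd (h1.trans h2.symm) h3

/-- The state on entering the `r`-th Gray code in the block replacing vertex `u`. -/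
def entryState (V : ℕ → ℕ → GridPoint d) (k u r : ℕ) : Fin d → Bool :=
  digitDiff V (k + 2) ((u * 2 ^ d + r) * 2 ^ d)

lemma entryState_ax (hS : FoldedSystem d V ax) {k u r : ℕ} (hu : u < (2 ^ d) ^ k)
    (h0 : 0 < r) (hr : r < 2 ^ d) : entryState V k u r (ax (k + 1) (u * 2 ^ d + r)) = true :=
  hS.digitDiff_inside hu h0 hr

lemma entryState_succ (hS : FoldedSystem d V ax) (hd : 0 < d) {k u r : ℕ} (hu : u < (2 ^ d) ^ k)
    (hr : r + 1 < 2 ^ d) : entryState V k u (r + 1) =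
      flipAt (entryState V k u r) (pos ax (k + 1) (u * 2 ^ d + r) (d - 1)) :=
  hS.digitDiff_next hd (mul_add_lt hu hr)

lemma ax_odd (hS : FoldedSystem d V ax) {k u s : ℕ} (hu : u < (2 ^ d) ^ k)
    (hs : 2 * s + 1 < 2 ^ d) : ax (k + 1) (u * 2 ^ d + (2 * s + 1)) = pos ax k u 0 := by
  simpa using hS.ax_eq_pos (n := 0) (q := s) hu (by simpa using hs)

/-- Two successive Gray codes lie between edges on axes b, j, b, where b is axis 0 of the block.
Each ends with a flip of b or j. The state must be true on the axis of each edge when that edge is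
crossed, which forces both flips to be equal and to hit j exactly when the state is false there. -/
lemma entryState_block (hS : FoldedSystem d V ax) (hd : 3 ≤ d) {k u s : ℕ}
    (hu : u < (2 ^ d) ^ k) (hs : 2 * s + 3 < 2 ^ d) :
    entryState V k u (2 * s + 3) = entryState V k u (2 * s + 1) ∧
    pos ax (k + 1) (u * 2 ^ d + (2 * s + 1)) (d - 1) =
      (if entryState V k u (2 * s + 1) (ax (k + 1) (u * 2 ^ d + (2 * s + 2))) = true
        then pos ax k u 0 else ax (k + 1) (u * 2 ^ d + (2 * s + 2))) := by
  have h1 := hS.entryState_succ (by omega) hu (show 2 * s + 1 + 1 < 2 ^ d by omega)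
  have h2 := hS.entryState_succ (by omega) hu (show 2 * s + 2 + 1 < 2 ^ d by omega)
  have a1 := hS.ax_odd hu (show 2 * s + 1 < 2 ^ d by omega)
  have a3 := hS.ax_odd (s := s + 1) hu (show 2 * (s + 1) + 1 < 2 ^ d by omega)
  rw [show 2 * (s + 1) + 1 = 2 * s + 3 by ring] at a3
  have e1 := hS.entryState_ax hu (show 0 < 2 * s + 1 by omega) (by omega)
  have e2 := hS.entryState_ax hu (show 0 < 2 * s + 2 by omega) (by omega)
  have e3 := hS.entryState_ax hu (show 0 < 2 * s + 3 by omega) (by omega)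
  have hl1 := mul_add_lt hu (show 2 * s + 2 < 2 ^ d by omega)
  have hl2 := mul_add_lt hu (show 2 * s + 3 < 2 ^ d by omega)
  have l1 := hS.last_pair hd (show 0 < u * 2 ^ d + (2 * s + 1) by omega) hl1
  have l2 := hS.last_pair hd (show 0 < u * 2 ^ d + (2 * s + 2) by omega) hl2
  have hne := hS.ax_ne_succ hd (show 0 < u * 2 ^ d + (2 * s + 1) by omega) hl1
  rw [show u * 2 ^ d + (2 * s + 1) + 1 = u * 2 ^ d + (2 * s + 2) by ring] at l1 hne
  rw [show u * 2 ^ d + (2 * s + 2) + 1 = u * 2 ^ d + (2 * s + 3) by ring] at l2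
  rw [a1] at e1 l1 hne
  rw [a3] at e3 l2
  simp only [add_assoc, Nat.reduceAdd] at h1 h2
  generalize ax (k + 1) (u * 2 ^ d + (2 * s + 2)) = j at *
  generalize pos ax k u 0 = b at *
  have c1 : pos ax (k + 1) (u * 2 ^ d + (2 * s + 1)) (d - 1) = b ∨
    pos ax (k + 1) (u * 2 ^ d + (2 * s + 1)) (d - 1) = j := by tauto
  have c2 : pos ax (k + 1) (u * 2 ^ d + (2 * s + 2)) (d - 1) = b ∨
    pos ax (k + 1) (u * 2 ^ d + (2 * s + 2)) (d - 1) = j := by tauto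
  generalize pos ax (k + 1) (u * 2 ^ d + (2 * s + 1)) (d - 1) = c at *
  generalize pos ax (k + 1) (u * 2 ^ d + (2 * s + 2)) (d - 1) = c' at *
  rw [h1] at h2 e2
  rw [h2] at e3 ⊢
  rcases c1 with rfl | rfl <;> rcases c2 with rfl | rfl
  · rw [flipAt_of_ne _ hne.symm] at e2
    exact ⟨flipAt_flipAt _ _, by simp [e2]⟩
  · simp [flipAt_apply, hne, e1] at e3
  · simp [flipAt_apply, hne, e1] at e3
  · rw [flipAt_self] at e2
    exact ⟨flipAt_flipAt _ _, by simp at e2; simp [e2]⟩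

lemma entryState_odd (hS : FoldedSystem d V ax) (hd : 3 ≤ d) {k u : ℕ} (hu : u < (2 ^ d) ^ k) :
    ∀ s, 2 * s + 1 < 2 ^ d → entryState V k u (2 * s + 1) = entryState V k u 1 := by
  intro s
  induction s with
  | zero => simp
  | succ s ih =>
    intro hs
    rw [← ih (by omega)]
    exact (hS.entryState_block hd hu (show 2 * s + 3 < 2 ^ d by omega)).1

lemma entryState_one_pos_zero (hS : FoldedSystem d V ax) (hd : 3 ≤ d) {k u : ℕ}
    (hu : u < (2 ^ d) ^ k) : entryState V k u 1 (pos ax k u 0) = true := by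
  have hN : 1 < 2 ^ d := Nat.one_lt_two_pow (by omega)
  have := hS.entryState_ax hu one_pos hN
  rwa [show u * 2 ^ d + 1 = u * 2 ^ d + (2 * 0 + 1) by ring, hS.ax_odd hu (by omega)] at this

lemma pos_last_even (hS : FoldedSystem d V ax) (hd : 3 ≤ d) {k u s : ℕ}
    (hu : u < (2 ^ d) ^ k) (hs : 2 * s + 3 < 2 ^ d) :
    pos ax (k + 1) (u * 2 ^ d + (2 * s + 1)) (d - 1) =
      (if entryState V k u 1 (ax (k + 1) (u * 2 ^ d + (2 * s + 2))) = true
        then pos ax k u 0 else ax (k + 1) (u * 2 ^ d + (2 * s + 2))) := by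
  rw [← hS.entryState_odd hd hu s (by omega)]
  exact (hS.entryState_block hd hu hs).2

/-! ### Copies of a curve inside the next one. -/

/-- For k ≥ 2 the offset 2^k w is divisible by 4, and x ↦ 2^k - 1 - x complements both low digits,
so their agreement is preserved. -/
lemma similar_digitDiff (hS : FoldedSystem d V ax) {k t : ℕ} (hk : 2 ≤ k) (ht : t < 2 ^ d) :
    ∃ π : Equiv.Perm (Fin d),
      ((∀ m, 0 < m → m < (2 ^ d) ^ k → ax (k + 1) (t * (2 ^ d) ^ k + m) = π (ax k m)) ∧
        ∀ m < (2 ^ d) ^ k, ∀ j,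
          digitDiff V (k + 1) (t * (2 ^ d) ^ k + m) (π j) = digitDiff V k m j) ∨
      ((∀ m, 0 < m → m < (2 ^ d) ^ k →
          ax (k + 1) (t * (2 ^ d) ^ k + m) = π (ax k ((2 ^ d) ^ k - m))) ∧
        ∀ m < (2 ^ d) ^ k, ∀ j,
          digitDiff V (k + 1) (t * (2 ^ d) ^ k + m) (π j) =
            digitDiff V k ((2 ^ d) ^ k - 1 - m) j) := by
  obtain ⟨π, ρ, hρ, h⟩ := hS.similar k t ht
  have hdig : ∀ m < (2 ^ d) ^ k, ∀ j,
      digitDiff V (k + 1) (t * (2 ^ d) ^ k + m) (π j) = digitDiff V k (ρ m) j := by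
    intro m hm j
    obtain ⟨r, rfl⟩ := Nat.exists_eq_add_of_le hk
    have e : (2 : ℤ) ^ (2 + r) = 4 * 2 ^ r := by ring
    obtain ⟨w, hw | hw⟩ := h j
    · have := hw m hm
      rw [e, mul_assoc] at this
      unfold digitDiff
      rw [decide_eq_decide]
      omega
    · have := hw m hm
      rw [e, mul_assoc] at this
      unfold digitDiff
      rw [decide_eq_decide]
      omega
  have hax : ∀ m, 0 < m → m < (2 ^ d) ^ k → ∀ j, V k (ρ m) j ≠ V k (ρ (m - 1)) j →
      ax (k + 1) (t * (2 ^ d) ^ k + m) = π j := by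
    intro m h0 hm j hj
    have hlt : t * (2 ^ d) ^ k + m < (2 ^ d) ^ (k + 1) := by
      calc t * (2 ^ d) ^ k + m < t * (2 ^ d) ^ k + (2 ^ d) ^ k := by omega
        _ = (t + 1) * (2 ^ d) ^ k := by ring
        _ ≤ 2 ^ d * (2 ^ d) ^ k := Nat.mul_le_mul_right _ ht
        _ = (2 ^ d) ^ (k + 1) := by ring
    refine hS.eq_ax (by omega) hlt ?_
    rw [show t * (2 ^ d) ^ k + m - 1 = t * (2 ^ d) ^ k + (m - 1) by omega]
    obtain ⟨w, hw | hw⟩ := h j <;>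
    · have h1 := hw m hm
      have h2 := hw (m - 1) (by omega)
      omega
  refine ⟨π, ?_⟩
  rcases hρ with hρ | hρ
  · left
    simp only [hρ] at hdig hax
    exact ⟨fun m h0 hm => hax m h0 hm _ (hS.ax_changes h0 hm), hdig⟩
  · right
    simp only [hρ] at hdig hax
    refine ⟨fun m h0 hm => hax m h0 hm _ ?_, hdig⟩
    rw [show (2 ^ d) ^ k - 1 - (m - 1) = (2 ^ d) ^ k - m by omega,
      show (2 ^ d) ^ k - 1 - m = (2 ^ d) ^ k - m - 1 by omega]
    exact (hS.ax_changes (by omega) (by omega)).symm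

lemma two_pow_lt {n : ℕ} (hn : n < d) : 2 ^ n < 2 ^ d := Nat.pow_lt_pow_right (by norm_num) hn

/-- The copy of the second curve in block `t` of the third curve. -/
lemma transport (hS : FoldedSystem d V ax) (hd : 3 ≤ d) {t : ℕ} (ht : t < 2 ^ d) :
    ∃ π : Equiv.Perm (Fin d), (∀ n < d, pos ax 1 t n = π (pos ax 0 0 n)) ∧
      (∀ j, entryState V 1 t 1 (π j) = entryState V 0 0 1 j) ∧
      (((∀ j, digitDiff V 3 (t * 2 ^ d * 2 ^ d) (π j) = digitDiff V 2 0 j) ∧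
        (∀ j, digitDiff V 3 ((t + 1) * 2 ^ d * 2 ^ d - 1) (π j) =
          digitDiff V 2 ((2 ^ d) ^ 2 - 1) j) ∧
        ∀ n < d, pos ax 2 (t * 2 ^ d) n = π (pos ax 1 0 n)) ∨
      ((∀ j, digitDiff V 3 (t * 2 ^ d * 2 ^ d) (π j) = digitDiff V 2 ((2 ^ d) ^ 2 - 1) j) ∧
        (∀ j, digitDiff V 3 ((t + 1) * 2 ^ d * 2 ^ d - 1) (π j) = digitDiff V 2 0 j) ∧
        ∀ n < d, pos ax 2 ((t + 1) * 2 ^ d - 1) n = π (pos ax 1 0 n))) := by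
  obtain ⟨π, h⟩ := hS.similar_digitDiff le_rfl ht
  have hN : 8 ≤ 2 ^ d := by
    calc 8 = 2 ^ 3 := by norm_num
      _ ≤ 2 ^ d := Nat.pow_le_pow_right (by norm_num) hd
  have hN2 : 2 ^ d * 2 ^ d = (2 ^ d) ^ 2 := by ring
  have hNN : 8 * 2 ^ d ≤ (2 ^ d) ^ 2 := by rw [← hN2]; exact Nat.mul_le_mul_right _ hN
  have hf : ∀ n < d, pos ax 1 t n = ax 3 (t * (2 ^ d) ^ 2 + 2 ^ n * 2 ^ d) := by
    intro n hn
    have : t * 2 ^ d + 2 ^ n < (2 ^ d) ^ 2 := mul_add_lt (by simpa using ht) (two_pow_lt hn)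
    rw [pos, ← hS.ax_mul (by positivity) this]
    congr 1
    ring
  have hlt : ∀ n < d, 2 ^ n * 2 ^ d < (2 ^ d) ^ 2 := by
    intro n hn
    rw [← hN2]
    exact Nat.mul_lt_mul_of_pos_right (two_pow_lt hn) (by positivity)
  have e1 : entryState V 1 t 1 = digitDiff V 3 (t * (2 ^ d) ^ 2 + 2 ^ d) := by
    rw [entryState]; congr 1; ring
  have e2 : entryState V 0 0 1 = digitDiff V 2 (2 ^ d) := by
    rw [entryState]; congr 1; ring
  have e3 : (t + 1) * 2 ^ d * 2 ^ d - 1 = t * (2 ^ d) ^ 2 + ((2 ^ d) ^ 2 - 1) := by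
    rw [add_mul, add_mul, one_mul, mul_assoc, hN2]; omega
  have e4 : t * 2 ^ d * 2 ^ d = t * (2 ^ d) ^ 2 + 0 := by ring
  refine ⟨π, ?_⟩
  rcases h with ⟨h1, h2⟩ | ⟨h1, h2⟩
  · refine ⟨fun n hn => ?_, fun j => ?_, Or.inl ⟨fun j => ?_, fun j => ?_, fun n hn => ?_⟩⟩
    · rw [hf n hn, h1 _ (by positivity) (hlt n hn),
        hS.ax_mul (k := 1) (by positivity) (by simpa using two_pow_lt hn)]
      simp [pos]
    · rw [e1, e2, h2 _ (by omega)]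
    · rw [e4, h2 _ (by omega)]
    · rw [e3, h2 _ (by omega)]
    · have := two_pow_lt hn
      rw [pos, e4, add_assoc, zero_add, h1 _ (by positivity) (by omega)]
      simp [pos]
  · refine ⟨fun n hn => ?_, fun j => ?_, Or.inr ⟨fun j => ?_, fun j => ?_, fun n hn => ?_⟩⟩
    · have hn' := two_pow_lt hn
      have hp : 0 < 2 ^ n := by positivity
      rw [hf n hn, h1 _ (by positivity) (hlt n hn), ← hN2, ← Nat.sub_mul,
        hS.ax_mul (k := 1) (by omega) (by rw [pow_one]; omega)]
      have := hS.ax_sub_eq_pos (k := 0) (i := 1) (q := 0) one_pos (by simp) hn (by simpa using hn')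
      simp only [one_mul, mul_zero, zero_add, mul_one, Nat.sub_self] at this
      rw [this]
    · rw [e1, e2, h2 _ (by omega)]
      -- Reversal turns the entry of Gray code 1 into the exit of the last but one. That exit has
      -- the state in which the last one is entered, whose index 2^d - 1 is odd.
      have hodd := hS.entryState_odd hd (k := 0) (u := 0) (by simp) (2 ^ (d - 1) - 1)
      have hN' : 2 ^ d = 2 * 2 ^ (d - 1) := by
        rw [← pow_succ']; congr 1; omega
      have hc := hS.digitDiff_cross (k := 1) (i := 2 ^ d - 1) (by omega) (by rw [pow_one]; omega)
      rw [show 2 * (2 ^ (d - 1) - 1) + 1 = 2 ^ d - 1 by omega] at hodd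
      have := hodd (by omega)
      simp only [entryState, zero_mul, zero_add, one_mul] at this
      have e5 : (2 ^ d) ^ 2 - 1 - 2 ^ d = (2 ^ d - 1) * 2 ^ d - 1 := by
        rw [Nat.sub_mul, hN2, one_mul]
        omega
      rw [← this, hc, e5]
    · rw [e4, h2 _ (by omega)]; rfl
    · rw [e3, h2 _ (by omega), Nat.sub_self]
    · have hn' := two_pow_lt hn
      have hp : 0 < 2 ^ n := by positivity
      have : ((t + 1) * 2 ^ d - 1) * 2 ^ d + 2 ^ n =
          t * (2 ^ d) ^ 2 + ((2 ^ d) ^ 2 - (2 ^ d - 2 ^ n)) := by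
        rw [Nat.sub_mul, add_mul, add_mul, mul_assoc, hN2, one_mul, hN2]; omega
      rw [pos, this, h1 _ (by omega) (by omega),
        show (2 ^ d) ^ 2 - ((2 ^ d) ^ 2 - (2 ^ d - 2 ^ n)) = 2 ^ d - 2 ^ n by omega]
      have := hS.ax_sub_eq_pos (k := 1) (i := 1) (q := 0) one_pos (by rw [pow_one]; omega) hn
        (by simpa using hn')
      simp only [one_mul, mul_zero, zero_add, mul_one, Nat.sub_self] at this
      rw [this]

end FoldedSystem

/-! ### States at the gates between the blocks of the third curve. -/

namespace FoldedSystem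

variable {d : ℕ} {V : ℕ → ℕ → GridPoint d} {ax : ℕ → ℕ → Fin d}

lemma eight_le (hd : 3 ≤ d) : 8 ≤ 2 ^ d := by
  calc 8 = 2 ^ 3 := by norm_num
    _ ≤ 2 ^ d := Nat.pow_le_pow_right (by norm_num) hd

/-- With only `e` and `a` available, the prescribed value on `e` decides whether the flip hits `e`.
It is applied with `X` a gate, `D` the common state of a block and `e` the axis of the edge through
the gate. -/
lemma flip_axis_eq {X D : Fin d → Bool} {c e a : Fin d} (hX : X = flipAt D c)
    (hc : c = e ∨ c = a) (hea : e ≠ a) (he : X e = false) :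
    c = if D e = true then e else a := by
  subst hX
  rcases hc with rfl | rfl
  · rw [flipAt_self] at he
    simp at he
    simp [he]
  · rw [flipAt_of_ne _ hea] at he
    simp [he]

lemma digitDiff_gate (hS : FoldedSystem d V ax) {t : ℕ} (h0 : 0 < t) (ht : t < 2 ^ d) :
    digitDiff V 3 (t * 2 ^ d * 2 ^ d) (ax 1 t) = false :=
  hS.digitDiff_outside (k := 1) h0 (by simpa using ht)

lemma gate_index_lt {t : ℕ} (hd : 0 < d) (ht : t < 2 ^ d) : t * 2 ^ d + 1 < (2 ^ d) ^ 2 :=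
  mul_add_lt (k := 1) (by simpa using ht) (Nat.one_lt_two_pow (by omega))

lemma gate_next (hS : FoldedSystem d V ax) (hd : 3 ≤ d) {t : ℕ} (h0 : 0 < t) (ht : t < 2 ^ d) :
    ax 2 (t * 2 ^ d) = ax 1 t ∧ ax 2 (t * 2 ^ d + 1) = pos ax 1 t 0 ∧
    pos ax 2 (t * 2 ^ d) (d - 1) =
      (if entryState V 1 t 1 (ax 1 t) = true then ax 1 t else pos ax 1 t 0) ∧
    digitDiff V 3 (t * 2 ^ d * 2 ^ d) = flipAt (entryState V 1 t 1)
      (if entryState V 1 t 1 (ax 1 t) = true then ax 1 t else pos ax 1 t 0) := by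
  have hN := eight_le hd
  have ht1 : t < (2 ^ d) ^ 1 := by simpa using ht
  have e1 := hS.ax_mul (k := 1) h0 ht1
  have e2 := hS.ax_odd (k := 1) (u := t) (s := 0) ht1 (by omega)
  simp only [mul_zero, zero_add] at e2
  have hX := hS.entryState_succ (k := 1) (u := t) (r := 0) (by omega) ht1 (by omega)
  have hY : entryState V 1 t 0 = digitDiff V 3 (t * 2 ^ d * 2 ^ d) := by simp [entryState]
  rw [hY, add_zero, zero_add] at hX
  have hX' := congrArg (fun X => flipAt X (pos ax 2 (t * 2 ^ d) (d - 1))) hX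
  simp only [flipAt_flipAt] at hX'
  have hp := hS.last_pair hd (k := 2) (i := t * 2 ^ d) (by positivity)
    (gate_index_lt (by omega) ht)
  have hne := hS.ax_ne_succ hd (k := 2) (i := t * 2 ^ d) (by positivity)
    (gate_index_lt (by omega) ht)
  rw [e1, e2] at hp hne
  have hc := flip_axis_eq hX'.symm (by tauto) hne (hS.digitDiff_gate h0 ht)
  refine ⟨e1, e2, hc, ?_⟩
  rw [← hX', hc]

lemma gate_prev (hS : FoldedSystem d V ax) (hd : 3 ≤ d) {t : ℕ} (ht : t + 1 < 2 ^ d) :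
    ax 2 ((t + 1) * 2 ^ d) = ax 1 (t + 1) ∧ ax 2 ((t + 1) * 2 ^ d - 1) = pos ax 1 t 0 ∧
    pos ax 2 ((t + 1) * 2 ^ d - 1) (d - 1) =
      (if entryState V 1 t 1 (ax 1 (t + 1)) = true then ax 1 (t + 1) else pos ax 1 t 0) ∧
    digitDiff V 3 ((t + 1) * 2 ^ d * 2 ^ d) = flipAt (entryState V 1 t 1)
      (if entryState V 1 t 1 (ax 1 (t + 1)) = true then ax 1 (t + 1) else pos ax 1 t 0) := by
  have hN := eight_le hd
  have hN' : 2 ^ d = 2 * 2 ^ (d - 1) := by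
    rw [← pow_succ']; congr 1; omega
  have ht1 : t + 1 < (2 ^ d) ^ 1 := by simpa using ht
  have hle : 2 ^ d ≤ (t + 1) * 2 ^ d := Nat.le_mul_of_pos_left _ (by omega)
  have hlt := gate_index_lt (by omega) ht
  have hpred : (t + 1) * 2 ^ d - 1 + 1 = (t + 1) * 2 ^ d := by omega
  have e1 := hS.ax_mul (k := 1) (Nat.succ_pos t) ht1
  have e2 := hS.ax_sub_eq_pos (k := 1) (i := t + 1) (n := 0) (q := 0) (Nat.succ_pos t) ht1.le
    (by omega) (by simpa using (by omega : 1 < 2 ^ d))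
  simp only [Nat.add_sub_cancel, mul_zero, zero_add, pow_zero, mul_one, Nat.succ_eq_add_one]
    at e1 e2
  have hX := hS.digitDiff_next (k := 2) (i := (t + 1) * 2 ^ d - 1) (by omega) (by omega)
  rw [hpred] at hX
  have hY : digitDiff V 3 (((t + 1) * 2 ^ d - 1) * 2 ^ d) = entryState V 1 t 1 := by
    have := hS.entryState_odd hd (k := 1) (u := t) (by omega) (2 ^ (d - 1) - 1) (by omega)
    rw [← this, entryState]
    congr 2
    rw [add_mul]
    omega
  simp only [Nat.reduceAdd] at hX
  rw [hY] at hX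
  have hp := hS.last_pair hd (k := 2) (i := (t + 1) * 2 ^ d - 1) (by omega) (by omega)
  have hne := hS.ax_ne_succ hd (k := 2) (i := (t + 1) * 2 ^ d - 1) (by omega) (by omega)
  rw [hpred, e1, e2] at hp hne
  have hc := flip_axis_eq hX (by tauto) hne.symm (hS.digitDiff_gate (Nat.succ_pos t) ht)
  refine ⟨e1, e2, hc, ?_⟩
  rw [hX, hc]

lemma entryState_pos (hS : FoldedSystem d V ax) (hd : 3 ≤ d) {t n : ℕ} (ht : t < 2 ^ d)
    (hn : n < d) : entryState V 1 t 1 (pos ax 1 t n) = entryState V 0 0 1 (pos ax 0 0 n) := by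
  obtain ⟨π, h1, h2, -⟩ := hS.transport hd ht
  rw [h1 n hn, h2]

lemma ax_one_two_pow (n : ℕ) : ax 1 (2 ^ n) = pos ax 0 0 n := by simp [pos]

lemma ax_one_odd (hS : FoldedSystem d V ax) {n q : ℕ} (h : 2 ^ n * (2 * q + 1) < 2 ^ d) :
    ax 1 (2 ^ n * (2 * q + 1)) = pos ax 0 0 n := by
  simpa using hS.ax_eq_pos (k := 0) (i := 0) (by simp) h

/-- Seen from a block, both its gates arise from the common state by flipping axis 0 of the block,
so all gates coincide. Each axis carries the edge through some gate, where its bit is false. -/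
lemma gates_of_both_false (hS : FoldedSystem d V ax) (hd : 3 ≤ d)
    (hz : entryState V 0 0 1 (pos ax 0 0 (d - 2)) = false)
    (hw : entryState V 0 0 1 (pos ax 0 0 (d - 1)) = false) :
    ∀ t, 0 < t → t < 2 ^ d → ∀ j, digitDiff V 3 (t * 2 ^ d * 2 ^ d) j = false := by
  have hN := eight_le hd
  have hsucc : ∀ t, 0 < t → t + 1 < 2 ^ d →
      digitDiff V 3 ((t + 1) * 2 ^ d * 2 ^ d) = digitDiff V 3 (t * 2 ^ d * 2 ^ d) := by
    intro t h0 ht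
    have h1 := (hS.gate_prev hd ht).2.2.2
    have h2 := (hS.gate_next hd h0 (by omega)).2.2.2
    have e1 : entryState V 1 t 1 (ax 1 t) = false := by
      rcases hS.ax_mem hd (k := 1) h0 (by rw [pow_one]; omega) with h | h <;>
        rw [h, hS.entryState_pos hd (by omega) (by omega)] <;> assumption
    have e2 : entryState V 1 t 1 (ax 1 (t + 1)) = false := by
      rcases hS.ax_mem_pred hd (k := 1) (Nat.succ_pos t) (by rw [pow_one]; omega) with h | h <;>
        rw [Nat.succ_eq_add_one, Nat.add_sub_cancel] at h <;>
        rw [h, hS.entryState_pos hd (by omega) (by omega)] <;> assumption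
    rw [h1, h2, e1, e2]
    simp
  have hall : ∀ t, t + 1 < 2 ^ d →
      digitDiff V 3 ((t + 1) * 2 ^ d * 2 ^ d) = digitDiff V 3 ((0 + 1) * 2 ^ d * 2 ^ d) := by
    intro t
    induction t with
    | zero => simp
    | succ t ih => exact fun ht => (hsucc (t + 1) (by omega) ht).trans (ih (by omega))
  intro t h0 ht j
  obtain ⟨n, hn, rfl⟩ := hS.pos_surj (k := 0) (i := 0) (by simp) j
  have h1 := hall (t - 1) (by omega)
  have hp : 0 < 2 ^ n := by positivity
  have h2 := hall (2 ^ n - 1) (by have := two_pow_lt hn; omega)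
  rw [Nat.sub_add_cancel h0] at h1
  rw [Nat.sub_add_cancel hp] at h2
  rw [h1, ← h2, ← ax_one_two_pow (ax := ax) n]
  exact hS.digitDiff_gate hp (two_pow_lt hn)

/-- Now each gate differs from the common state on the axis of its own edge. Undoing that flip
yields a state independent of `t`, which is true on every axis. -/
lemma gates_of_both_true (hS : FoldedSystem d V ax) (hd : 3 ≤ d)
    (hz : entryState V 0 0 1 (pos ax 0 0 (d - 2)) = true)
    (hw : entryState V 0 0 1 (pos ax 0 0 (d - 1)) = true) :
    ∀ t, 0 < t → t < 2 ^ d → ∀ j,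
      digitDiff V 3 (t * 2 ^ d * 2 ^ d) j = decide (j ≠ ax 1 t) := by
  have hN := eight_le hd
  have hsucc : ∀ t, 0 < t → t + 1 < 2 ^ d →
      flipAt (digitDiff V 3 ((t + 1) * 2 ^ d * 2 ^ d)) (ax 1 (t + 1)) =
      flipAt (digitDiff V 3 (t * 2 ^ d * 2 ^ d)) (ax 1 t) := by
    intro t h0 ht
    have h1 := (hS.gate_prev hd ht).2.2.2
    have h2 := (hS.gate_next hd h0 (by omega)).2.2.2
    have e1 : entryState V 1 t 1 (ax 1 t) = true := by
      rcases hS.ax_mem hd (k := 1) h0 (by rw [pow_one]; omega) with h | h <;>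
        rw [h, hS.entryState_pos hd (by omega) (by omega)] <;> assumption
    have e2 : entryState V 1 t 1 (ax 1 (t + 1)) = true := by
      rcases hS.ax_mem_pred hd (k := 1) (Nat.succ_pos t) (by rw [pow_one]; omega) with h | h <;>
        rw [Nat.succ_eq_add_one, Nat.add_sub_cancel] at h <;>
        rw [h, hS.entryState_pos hd (by omega) (by omega)] <;> assumption
    rw [h1, h2, e1, e2]
    simp [flipAt_flipAt]
  have hall : ∀ t, t + 1 < 2 ^ d →
      flipAt (digitDiff V 3 ((t + 1) * 2 ^ d * 2 ^ d)) (ax 1 (t + 1)) =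
      flipAt (digitDiff V 3 ((0 + 1) * 2 ^ d * 2 ^ d)) (ax 1 (0 + 1)) := by
    intro t
    induction t with
    | zero => simp
    | succ t ih => exact fun ht => (hsucc (t + 1) (by omega) ht).trans (ih (by omega))
  intro t h0 ht j
  obtain ⟨n, hn, rfl⟩ := hS.pos_surj (k := 0) (i := 0) (by simp) j
  have h1 := hall (t - 1) (by omega)
  have hp : 0 < 2 ^ n := by positivity
  have h2 := hall (2 ^ n - 1) (by have := two_pow_lt hn; omega)
  rw [Nat.sub_add_cancel h0] at h1
  rw [Nat.sub_add_cancel hp] at h2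
  have h3 := congrFun (h1.trans h2.symm) (ax 1 (2 ^ n))
  rw [flipAt_self, hS.digitDiff_gate hp (two_pow_lt hn)] at h3
  rw [← ax_one_two_pow (ax := ax) n]
  by_cases h : ax 1 (2 ^ n) = ax 1 t
  · rw [h, hS.digitDiff_gate h0 ht]; simp
  · rw [flipAt_of_ne _ h] at h3
    rw [h3]; simp [h]

/-- Block 2^n - 1 lies between edges on axes 0 and n of A_1, which are its last two axes.
`pos_last_even` tells their order, and the flip in `gate_next` does not touch axis n. -/
lemma gate_before_two_pow (hS : FoldedSystem d V ax) (hd : 3 ≤ d) {n : ℕ} (h0 : 0 < n)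
    (hn : n < d) :
    (pos ax 0 0 n = pos ax 1 (2 ^ n - 1) (d - 2) ∨
      pos ax 0 0 n = pos ax 1 (2 ^ n - 1) (d - 1)) ∧
    digitDiff V 3 ((2 ^ n - 1) * 2 ^ d * 2 ^ d) (pos ax 0 0 n) =
      if entryState V 0 0 1 (pos ax 0 0 n) = true
      then entryState V 0 0 1 (pos ax 0 0 (d - 2))
      else entryState V 0 0 1 (pos ax 0 0 (d - 1)) := by
  have hN := eight_le hd
  have hN' : 2 ^ d = 2 * 2 ^ (d - 1) := by
    rw [← pow_succ']; congr 1; omega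
  have hle : 2 ^ n ≤ 2 ^ (d - 1) := Nat.pow_le_pow_right (by norm_num) (by omega)
  obtain ⟨n, rfl⟩ := Nat.exists_eq_add_of_lt h0
  rw [zero_add] at *
  have e2 : 2 ^ (n + 1) = 2 * 2 ^ n := by ring
  have hp : 0 < 2 ^ n := by positivity
  have e3 : 2 ^ (n + 1) - 1 = 2 * (2 ^ n - 1) + 1 := by omega
  have hlast := hS.pos_last_even hd (k := 0) (u := 0) (s := 2 ^ n - 1) (by simp) (by omega)
  have hodd := hS.ax_odd (k := 0) (u := 0) (s := 2 ^ n - 1) (by simp) (by omega)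
  rw [zero_mul, zero_add, show 2 * (2 ^ n - 1) + 2 = 2 ^ (n + 1) by omega, ← e3, zero_add,
    zero_add, ax_one_two_pow (ax := ax)] at hlast
  rw [zero_mul, zero_add, zero_add, ← e3] at hodd
  have hp := hS.last_pair hd (k := 1) (i := 2 ^ (n + 1) - 1) (by omega) (by rw [pow_one]; omega)
  rw [show 2 ^ (n + 1) - 1 + 1 = 2 ^ (n + 1) by omega, hodd, ax_one_two_pow (ax := ax)] at hp
  have hg := (hS.gate_next hd (t := 2 ^ (n + 1) - 1) (by omega) (by omega)).2.2.2
  rw [hodd] at hg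
  have hne : pos ax 0 0 (n + 1) ≠ pos ax 0 0 0 :=
    hS.pos_ne (by simp) hn (by omega) (by omega)
  have hE := fun m (hm : m < d) => hS.entryState_pos hd (t := 2 ^ (n + 1) - 1) (by omega) hm
  have hA := fun m m' (hm : m < d) (hm' : m' < d) => hS.pos_ne (k := 1)
    (i := 2 ^ (n + 1) - 1) (by rw [pow_one]; omega) hm hm'
  have hne2 : pos ax 0 0 (n + 1) ≠ pos ax 1 (2 ^ (n + 1) - 1) 0 := by
    rcases hp with ⟨-, h⟩ | ⟨h, -⟩ <;> rw [← h] <;> exact hA _ _ (by omega) (by omega) (by omega)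
  have hne3 : pos ax 0 0 (n + 1) ≠ (if entryState V 1 (2 ^ (n + 1) - 1) 1 (pos ax 0 0 0) = true
      then pos ax 0 0 0 else pos ax 1 (2 ^ (n + 1) - 1) 0) := by
    split_ifs <;> assumption
  constructor
  · tauto
  · rw [hg, flipAt_of_ne _ hne3]
    split_ifs with h
    · rw [if_pos h] at hlast
      rw [hlast] at hp
      obtain ⟨-, hp⟩ | ⟨hp, -⟩ := hp
      · exact absurd hp.symm hne
      · rw [← hE _ (by omega), hp]
    · rw [if_neg h] at hlast
      rw [← hE _ (by omega), hlast]

/-- The gate before block 2^n - 1 is computed a second time, from block 2^n - 2. There axis n of A_1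
stands in place d - 3: axes 1 and 0 of A_1 take the last two places, and `pos_pred_mem` excludes the
earlier ones. -/
lemma third_last (hS : FoldedSystem d V ax) (hd : 4 ≤ d) {n : ℕ} (h0 : 2 ≤ n) (hn : n < d) :
    entryState V 0 0 1 (pos ax 0 0 (d - 3)) =
      if entryState V 0 0 1 (pos ax 0 0 n) = true
      then entryState V 0 0 1 (pos ax 0 0 (d - 2))
      else entryState V 0 0 1 (pos ax 0 0 (d - 1)) := by
  have hd' : 3 ≤ d := by omega
  have hN := eight_le hd'
  obtain ⟨hp, hg⟩ := hS.gate_before_two_pow hd' (n := n) (by omega) hn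
  rw [← hg]
  have hlt := two_pow_lt hn
  obtain ⟨n, rfl⟩ := Nat.exists_eq_add_of_le' h0
  have e2 : 2 ^ (n + 2) = 4 * 2 ^ n := by ring
  have hpos : 0 < 2 ^ n := by positivity
  set t := 2 ^ (n + 2) - 2 with ht
  have e3 : 2 ^ (n + 2) - 1 = t + 1 := by omega
  rw [e3] at hp ⊢
  have a1 : ax 1 t = pos ax 0 0 1 := by
    have := hS.ax_one_odd (n := 1) (q := 2 ^ n - 1) (by omega)
    rwa [show 2 ^ 1 * (2 * (2 ^ n - 1) + 1) = t by omega] at this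
  have a2 : ax 1 (t + 1) = pos ax 0 0 0 := by
    have := hS.ax_one_odd (n := 0) (q := 2 * 2 ^ n - 1) (by omega)
    rwa [show 2 ^ 0 * (2 * (2 * 2 ^ n - 1) + 1) = t + 1 by omega] at this
  have hl := hS.last_pair hd' (k := 1) (i := t) (by omega) (by rw [pow_one]; omega)
  rw [a1, a2] at hl
  have hne0 : pos ax 0 0 (n + 2) ≠ pos ax 0 0 0 := hS.pos_ne (by simp) hn (by omega) (by omega)
  have hne1 : pos ax 0 0 (n + 2) ≠ pos ax 0 0 1 := hS.pos_ne (by simp) hn (by omega) (by omega)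
  obtain ⟨m, hm, hmn⟩ := hS.pos_surj (k := 1) (i := t) (by rw [pow_one]; omega)
    (pos ax 0 0 (n + 2))
  have hm3 : m = d - 3 := by
    by_contra hne
    rcases (show m < d - 3 ∨ m = d - 2 ∨ m = d - 1 by omega) with h | rfl | rfl
    · rcases hS.pos_pred_mem hd' (k := 1) (i := t + 1) (by omega) (by rw [pow_one]; omega) h with
        h | ⟨m', hm', h⟩ <;> rw [Nat.add_sub_cancel, hmn] at h
      · exact hne0 (h.trans a2)
      · rw [h] at hp
        rcases hp with hp | hp <;>
          exact hS.pos_ne (by rw [pow_one]; omega) (by omega) (by omega) (by omega) hp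
    · rcases hl with ⟨h, -⟩ | ⟨h, -⟩ <;> rw [hmn] at h <;> contradiction
    · rcases hl with ⟨-, h⟩ | ⟨-, h⟩ <;> rw [hmn] at h <;> contradiction
  rw [hm3] at hmn
  rw [(hS.gate_prev hd' (t := t) (by omega)).2.2.2, a2, flipAt_of_ne, ← hmn,
    hS.entryState_pos hd' (by omega) (by omega)]
  split_ifs
  · exact hne0
  · rw [← hmn]
    exact hS.pos_ne (by rw [pow_one]; omega) (by omega) (by omega) (by omega)

/-- The last two axes of the first Gray code in the second curve. -/
lemma first_last_pair (hS : FoldedSystem d V ax) (hd : 3 ≤ d) :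
    ∃ y, (y = d - 2 ∨ y = d - 1) ∧
      ((entryState V 0 0 1 (pos ax 0 0 y) = true ∧ pos ax 1 0 (d - 1) = pos ax 0 0 y ∧
        pos ax 1 0 (d - 2) = pos ax 0 0 0) ∨
      (entryState V 0 0 1 (pos ax 0 0 y) = false ∧ pos ax 1 0 (d - 1) = pos ax 0 0 0 ∧
        pos ax 1 0 (d - 2) = pos ax 0 0 y)) := by
  have hN := eight_le hd
  obtain ⟨π, h1, h2, h3⟩ := hS.transport hd (t := 1) (by omega)
  have key : ∀ i e, (e = pos ax 1 1 (d - 2) ∨ e = pos ax 1 1 (d - 1)) →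
      (∀ n < d, pos ax 2 i n = π (pos ax 1 0 n)) →
      ((pos ax 2 i (d - 2) = e ∧ pos ax 2 i (d - 1) = pos ax 1 1 0) ∨
        (pos ax 2 i (d - 2) = pos ax 1 1 0 ∧ pos ax 2 i (d - 1) = e)) →
      pos ax 2 i (d - 1) = (if entryState V 1 1 1 e = true then e else pos ax 1 1 0) →
      e ≠ pos ax 1 1 0 →
      ∃ y, (y = d - 2 ∨ y = d - 1) ∧
      ((entryState V 0 0 1 (pos ax 0 0 y) = true ∧ pos ax 1 0 (d - 1) = pos ax 0 0 y ∧
        pos ax 1 0 (d - 2) = pos ax 0 0 0) ∨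
      (entryState V 0 0 1 (pos ax 0 0 y) = false ∧ pos ax 1 0 (d - 1) = pos ax 0 0 0 ∧
        pos ax 1 0 (d - 2) = pos ax 0 0 y)) := by
    intro i e he hi hp hl hne
    obtain ⟨y, hy, rfl⟩ : ∃ y, (y = d - 2 ∨ y = d - 1) ∧ e = pos ax 1 1 y := by
      rcases he with he | he
      exacts [⟨_, Or.inl rfl, he⟩, ⟨_, Or.inr rfl, he⟩]
    have hyd : y < d := by omega
    refine ⟨y, hy, ?_⟩
    rw [hS.entryState_pos hd (by omega) hyd] at hl
    rw [hi _ (by omega), hi _ (by omega), h1 y hyd, h1 0 (by omega)] at hp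
    rw [hi _ (by omega), h1 y hyd, h1 0 (by omega)] at hl
    rw [h1 y hyd, h1 0 (by omega)] at hne
    simp only [EmbeddingLike.apply_eq_iff_eq, ne_eq] at hp hne
    split_ifs at hl with h <;> rw [EmbeddingLike.apply_eq_iff_eq] at hl
    · left
      refine ⟨h, hl, ?_⟩
      rcases hp with ⟨-, hp⟩ | ⟨hp, -⟩
      · exact absurd (hl.symm.trans hp) hne
      · exact hp
    · right
      refine ⟨by simpa using h, hl, ?_⟩
      rcases hp with ⟨hp, -⟩ | ⟨-, hp⟩
      · exact hp
      · exact absurd (hp.symm.trans hl) hne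
  rcases h3 with ⟨-, -, h3⟩ | ⟨-, -, h3⟩
  · obtain ⟨e1, e2, e3, -⟩ := hS.gate_next hd (t := 1) one_pos (by omega)
    have hlt := gate_index_lt (d := d) (t := 1) (by omega) (by omega)
    have hp := hS.last_pair hd (k := 2) (by omega) hlt
    have hne := hS.ax_ne_succ hd (k := 2) (by omega) hlt
    rw [e1, e2] at hp hne
    exact key _ _ (hS.ax_mem hd one_pos (by rw [pow_one]; omega)) h3 (by tauto) e3 hne
  · obtain ⟨e1, e2, e3, -⟩ := hS.gate_prev hd (t := 1) (by omega)
    have hlt := gate_index_lt (d := d) (t := 1 + 1) (by omega) (by omega)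
    have hpred : (1 + 1) * 2 ^ d - 1 + 1 = (1 + 1) * 2 ^ d := by omega
    have hp := hS.last_pair hd (k := 2) (i := (1 + 1) * 2 ^ d - 1) (by omega) (by omega)
    have hne := hS.ax_ne_succ hd (k := 2) (i := (1 + 1) * 2 ^ d - 1) (by omega) (by omega)
    rw [hpred, e1, e2] at hp hne
    exact key _ _ (hS.ax_mem_pred hd (i := 1 + 1) (by omega) (by rw [pow_one]; omega)) h3
      (by tauto) e3 hne.symm

/-- `first_last_pair` leaves four arrangements of the three axes of block 0. In each of them,
computing the gate from block 0 gives false. -/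
lemma first_gate_three (hS : FoldedSystem d V ax) (hd : d = 3)
    (h : entryState V 0 0 1 (pos ax 0 0 1) ≠ entryState V 0 0 1 (pos ax 0 0 2)) :
    digitDiff V 3 (1 * 2 ^ d * 2 ^ d) (pos ax 0 0 1) = false := by
  have hd' : 3 ≤ d := hd.ge
  have hN := eight_le hd'
  have hg := (hS.gate_prev hd' (t := 0) (by omega)).2.2.2
  have e1 : ax 1 (0 + 1) = pos ax 0 0 0 := ax_one_two_pow 0
  rw [e1, zero_add] at hg
  have hE := fun m (hm : m < d) => hS.entryState_pos hd' (t := 0) (by omega) hm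
  have h00 := hS.entryState_one_pos_zero hd' (k := 0) (u := 0) (by simp)
  have n10 : pos ax 0 0 1 ≠ pos ax 0 0 0 :=
    hS.pos_ne (by simp) (by omega) (by omega) (by omega)
  have n12 : pos ax 0 0 1 ≠ pos ax 0 0 2 :=
    hS.pos_ne (by simp) (by omega) (by omega) (by omega)
  have m01 : pos ax 1 0 0 ≠ pos ax 1 0 1 :=
    hS.pos_ne (by simp) (by omega) (by omega) (by omega)
  have m02 : pos ax 1 0 0 ≠ pos ax 1 0 2 :=
    hS.pos_ne (by simp) (by omega) (by omega) (by omega)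
  have E0 := hE 0 (by omega)
  have E1 := hE 1 (by omega)
  have E2 := hE 2 (by omega)
  obtain ⟨m, hm, hm1⟩ := hS.pos_surj (k := 1) (i := 0) (by simp) (pos ax 0 0 1)
  obtain ⟨y, hy, hp⟩ := hS.first_last_pair hd'
  rw [show d - 1 = 2 by omega, show d - 2 = 1 by omega] at hp
  rw [show d - 1 = 2 by omega, show d - 2 = 1 by omega] at hy
  rw [hg, flipAt_apply]
  have hm' : m = 0 ∨ m = 1 ∨ m = 2 := by omega
  rcases hy with rfl | rfl <;> rcases hp with ⟨p1, p2, p3⟩ | ⟨p1, p2, p3⟩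
  · rw [p2] at E2
    rw [p3] at E1
    simp_all
  · rw [p2] at E2
    rw [p3] at E1
    simp_all
  · rw [p2] at E2
    rw [p3] at E1
    have : pos ax 1 0 0 = pos ax 0 0 1 := by
      rcases hm' with rfl | rfl | rfl
      · exact hm1
      · exact absurd (hm1.symm.trans p3) n10
      · exact absurd (hm1.symm.trans p2) n12
    rw [this] at E0
    simp_all
  · rw [p2] at E2
    rw [p3] at E1
    have : pos ax 1 0 0 = pos ax 0 0 1 := by
      rcases hm' with rfl | rfl | rfl
      · exact hm1
      · exact absurd (hm1.symm.trans p3) n12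
      · exact absurd (hm1.symm.trans p2) n10
    rw [this] at E0
    simp_all

lemma last_states_eq (hS : FoldedSystem d V ax) (hd : 3 ≤ d) :
    entryState V 0 0 1 (pos ax 0 0 (d - 2)) = entryState V 0 0 1 (pos ax 0 0 (d - 1)) := by
  rcases eq_or_lt_of_le hd with rfl | hd4
  · by_contra h
    have h1 := hS.first_gate_three rfl h
    have h2 := (hS.gate_before_two_pow hd (n := 1) one_pos (by omega)).2
    rw [show 2 ^ 1 - 1 = 1 by norm_num, h1] at h2
    revert h h2
    simp only [Nat.reduceSub]
    cases entryState V 0 0 1 (pos ax 0 0 1) <;> cases entryState V 0 0 1 (pos ax 0 0 2) <;> simp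
  -- The choice n = d - 2 gives z ∨ w and n = d - 1 gives z ∧ w, both for the value on the third
  -- last axis.
  · have h1 := hS.third_last hd4 (n := d - 2) (by omega) (by omega)
    have h2 := hS.third_last hd4 (n := d - 1) (by omega) (by omega)
    rw [h1] at h2
    revert h2
    cases entryState V 0 0 1 (pos ax 0 0 (d - 2)) <;>
      cases entryState V 0 0 1 (pos ax 0 0 (d - 1)) <;> simp

lemma gates (hS : FoldedSystem d V ax) (hd : 3 ≤ d) :
    (∀ t, 0 < t → t < 2 ^ d → ∀ j, digitDiff V 3 (t * 2 ^ d * 2 ^ d) j = false) ∨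
    ∀ t, 0 < t → t < 2 ^ d → ∃ y, ∀ j, digitDiff V 3 (t * 2 ^ d * 2 ^ d) j = decide (j ≠ y) := by
  have h := hS.last_states_eq hd
  cases hz : entryState V 0 0 1 (pos ax 0 0 (d - 2)) with
  | false => exact Or.inl (hS.gates_of_both_false hd hz (h ▸ hz))
  | true => exact Or.inr fun t h0 ht => ⟨_, hS.gates_of_both_true hd hz (h ▸ hz) t h0 ht⟩

/-- Block 1 of A_3 is a copy of A_2 running from gate 1 to gate 2. Later curves begin and end with a
copy of the previous curve, so their ends inherit any property stable under renaming axes. -/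
lemma ends_of_gates (hS : FoldedSystem d V ax) (hd : 3 ≤ d) (P : (Fin d → Bool) → Prop)
    (hP : ∀ (X Y : Fin d → Bool) (π : Equiv.Perm (Fin d)), (∀ j, X (π j) = Y j) → (P X ↔ P Y))
    (h : ∀ t, 0 < t → t < 2 ^ d → P (digitDiff V 3 (t * 2 ^ d * 2 ^ d))) (k : ℕ) :
    P (digitDiff V (k + 2) 0) ∧ P (digitDiff V (k + 2) ((2 ^ d) ^ (k + 2) - 1)) := by
  have hN := eight_le hd
  induction k with
  | zero =>
    obtain ⟨π, -, -, h3⟩ := hS.transport hd (t := 1) (by omega)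
    have hc := hS.digitDiff_cross (k := 2) (i := (1 + 1) * 2 ^ d) (by positivity)
      (by have := gate_index_lt (d := d) (t := 1 + 1) (by omega) (by omega); omega)
    simp only [Nat.reduceAdd] at hc h3
    rw [← hc] at h3
    have b1 := h 1 one_pos (by omega)
    have b2 := h 2 two_pos (by omega)
    rcases h3 with ⟨h1, h2, -⟩ | ⟨h1, h2, -⟩
    · exact ⟨(hP _ _ π h1).1 b1, (hP _ _ π h2).1 b2⟩
    · exact ⟨(hP _ _ π h2).1 b2, (hP _ _ π h1).1 b1⟩
  | succ k ih =>
    have hpos : 0 < (2 ^ d) ^ (k + 2) := by positivity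
    constructor
    · obtain ⟨π, h3⟩ := hS.similar_digitDiff (k := k + 2) (t := 0) (by omega) (by omega)
      simp only [zero_mul, zero_add] at h3
      rcases h3 with ⟨-, h3⟩ | ⟨-, h3⟩
      · exact (hP _ _ π (h3 0 hpos)).2 ih.1
      · exact (hP _ _ π (h3 0 hpos)).2 ih.2
    · obtain ⟨π, h3⟩ := hS.similar_digitDiff (k := k + 2) (t := 2 ^ d - 1) (by omega) (by omega)
      have e : (2 ^ d - 1) * (2 ^ d) ^ (k + 2) + ((2 ^ d) ^ (k + 2) - 1) =
          (2 ^ d) ^ (k + 2 + 1) - 1 := by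
        have : 2 ^ d * (2 ^ d) ^ (k + 2) = (2 ^ d) ^ (k + 2 + 1) := by ring
        have h8 : (2 ^ d) ^ (k + 2) ≤ 2 ^ d * (2 ^ d) ^ (k + 2) :=
          Nat.le_mul_of_pos_left _ (by positivity)
        rw [Nat.sub_mul, one_mul]
        omega
      rw [show k + 1 + 2 = k + 2 + 1 by ring, ← e]
      rcases h3 with ⟨-, h3⟩ | ⟨-, h3⟩
      · exact (hP _ _ π (h3 _ (by omega))).2 ih.2
      · refine (hP _ _ π (h3 _ (by omega))).2 ?_
        rw [Nat.sub_self]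
        exact ih.1

/-- The lowest two digits of the coordinates of the first vertex are either equal on all axes, or
different on all axes but one. -/
lemma digitDiff_first (hS : FoldedSystem d V ax) (hd : 3 ≤ d) :
    (∀ k j, digitDiff V (k + 2) 0 j = false) ∨
    ∀ k, ∃ y, ∀ j, digitDiff V (k + 2) 0 j = decide (j ≠ y) := by
  rcases hS.gates hd with h | h
  · refine Or.inl fun k => (hS.ends_of_gates hd (fun X => ∀ j, X j = false) ?_ h k).1
    intro X Y π hXY
    simp only [← hXY]
    exact π.forall_congr_right (q := fun j => X j = false) |>.symm
  · refine Or.inr fun k =>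
      (hS.ends_of_gates hd (fun X => ∃ y, ∀ j, X j = decide (j ≠ y)) ?_ h k).1
    intro X Y π hXY
    simp only [← hXY]
    constructor
    · rintro ⟨y, hy⟩
      exact ⟨π.symm y, fun j => by rw [hy, decide_eq_decide, ne_eq, ne_eq, Equiv.eq_symm_apply]⟩
    · rintro ⟨y, hy⟩
      refine ⟨π y, fun j => ?_⟩
      have := hy (π.symm j)
      rw [Equiv.apply_symm_apply] at this
      rw [this, decide_eq_decide, ne_eq, ne_eq, Equiv.symm_apply_eq]

end FoldedSystem

/-! ### The first vertex lies on a face. -/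

namespace FoldedSystem

variable {d : ℕ} {V : ℕ → ℕ → GridPoint d} {ax : ℕ → ℕ → Fin d}

lemma ancestor
    (hpar : ∀ k i m j, i < (2 ^ d) ^ k → m < 2 ^ d → V (k + 1) (i * 2 ^ d + m) j / 2 = V k i j)
    {t : ℕ} (ht : t < 2 ^ d) (j : Fin d) (k : ℕ) :
    ∀ m < (2 ^ d) ^ k, V (k + 1) (t * (2 ^ d) ^ k + m) j / 2 ^ k = V 1 t j := by
  induction k with
  | zero => intro m hm; obtain rfl : m = 0 := by simpa using hm
            simp
  | succ k ih =>
    intro m hm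
    have hN : 0 < 2 ^ d := by positivity
    have hm' : m / 2 ^ d < (2 ^ d) ^ k := by
      rw [Nat.div_lt_iff_lt_mul hN, ← pow_succ]; exact hm
    have hlt : t * (2 ^ d) ^ k + m / 2 ^ d < (2 ^ d) ^ (k + 1) := by
      calc _ < (t + 1) * (2 ^ d) ^ k := by rw [add_mul, one_mul]; omega
        _ ≤ 2 ^ d * (2 ^ d) ^ k := Nat.mul_le_mul_right _ ht
        _ = (2 ^ d) ^ (k + 1) := by ring
    have h := hpar (k + 1) _ _ j hlt (Nat.mod_lt m hN)
    rw [← ih _ hm', ← h, Int.ediv_ediv_of_nonneg (by norm_num), ← pow_succ']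
    congr 2
    have := Nat.div_add_mod m (2 ^ d)
    rw [add_mul, mul_assoc, ← pow_succ, add_assoc, mul_comm (m / 2 ^ d), this]

lemma vertex_bounds (hS : FoldedSystem d V ax) (h0 : ∀ j, V 0 0 j = 0) (j : Fin d) (k : ℕ) :
    ∀ m < (2 ^ d) ^ k, 0 ≤ V k m j ∧ V k m j < 2 ^ k := by
  induction k with
  | zero => intro m hm; obtain rfl : m = 0 := by simpa using hm
            simp [h0]
  | succ k ih =>
    intro m hm
    have hN : 0 < 2 ^ d := by positivity
    have hm' : m / 2 ^ d < (2 ^ d) ^ k := by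
      rw [Nat.div_lt_iff_lt_mul hN, ← pow_succ]; exact hm
    have h := hS.parent k _ _ j hm' (Nat.mod_lt m hN)
    rw [Nat.div_add_mod'] at h
    have := ih _ hm'
    have e : (2 : ℤ) ^ (k + 1) = 2 * 2 ^ k := by ring
    omega

lemma residue_of_ediv_ne {M a b w x : ℤ} (hx : 0 ≤ x) (hxM : x < M) (hb : b = M * w + x)
    (hab : a = b + 1 ∨ a = b - 1) (hne : a / M ≠ b / M) : x = 0 ∨ x = M - 1 := by
  have key : ∀ y, 0 ≤ y → y < M → (M * w + y) / M = w := by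
    intro y h0 hy
    rw [Int.add_comm, Int.add_mul_ediv_left _ _ (by omega), Int.ediv_eq_zero_of_lt h0 hy]
    ring
  by_contra hcon
  apply hne
  rw [hb, key x hx hxM]
  rcases hab with rfl | rfl
  · rw [hb, add_assoc, key _ (by omega) (by omega)]
  · rw [hb, add_sub_assoc, key _ (by omega) (by omega)]

/-- The first vertex lies on a face of the cube visited. -/
lemma exists_face (hS : FoldedSystem d V ax) (hd : 3 ≤ d) (h0 : ∀ j, V 0 0 j = 0) (k : ℕ) :
    ∃ j, V k 0 j = 0 ∨ V k 0 j = 2 ^ k - 1 := by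
  have hN := eight_le hd
  have hpos : 0 < (2 ^ d) ^ k := by positivity
  have hmul : ∀ t, t ≤ 2 → (t + 1) * (2 ^ d) ^ k ≤ (2 ^ d) ^ (k + 1) := fun t ht => by
    rw [pow_succ, mul_comm _ (2 ^ d)]
    exact Nat.mul_le_mul_right _ (by omega)
  have hm2 := hmul 2 le_rfl
  have key : ∀ t, t ≤ 1 → ∃ j,
      (V (k + 1) ((t + 1) * (2 ^ d) ^ k) j = V (k + 1) ((t + 1) * (2 ^ d) ^ k - 1) j + 1 ∨
      V (k + 1) ((t + 1) * (2 ^ d) ^ k) j = V (k + 1) ((t + 1) * (2 ^ d) ^ k - 1) j - 1) ∧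
      V (k + 1) ((t + 1) * (2 ^ d) ^ k) j / 2 ^ k ≠
        V (k + 1) ((t + 1) * (2 ^ d) ^ k - 1) j / 2 ^ k := by
    intro t ht
    have hlt : (t + 1) * (2 ^ d) ^ k < (2 ^ d) ^ (k + 1) := by
      have := hmul (t + 1) (by omega)
      rw [add_mul _ 1, one_mul] at this
      omega
    have h1 := hS.ax_changes (k := 1) (m := t + 1) (by omega) (by rw [pow_one]; omega)
    have a1 := ancestor hS.parent (t := t + 1) (by omega) (ax 1 (t + 1)) k 0 hpos
    have a2 := ancestor hS.parent (t := t) (by omega) (ax 1 (t + 1)) k ((2 ^ d) ^ k - 1) (by omega)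
    rw [show t * (2 ^ d) ^ k + ((2 ^ d) ^ k - 1) = (t + 1) * (2 ^ d) ^ k - 1 by
      rw [add_mul, one_mul]; omega] at a2
    rw [add_zero] at a1
    rw [Nat.add_sub_cancel, ← a1, ← a2] at h1
    have hax := hS.eq_ax (j := ax 1 (t + 1)) (by positivity) hlt (fun h => h1 (by rw [h]))
    refine ⟨ax 1 (t + 1), ?_, h1⟩
    have := hS.step_ax _ _ (by positivity) hlt
    rwa [hax] at this
  -- Copy 1 has neighbouring copies at both ends. The start of A_k corresponds to its entry, or to
  -- its exit if reversed, and either end is joined to another cube by a unit edge.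
  obtain ⟨π, ρ, hρ, hw⟩ := hS.similar k 1 (by omega)
  rcases hρ with hρ | hρ
  · obtain ⟨j, h1, h2⟩ := key 0 (by omega)
    obtain ⟨w, h3⟩ := hw (π.symm j)
    refine ⟨π.symm j, ?_⟩
    have hb := hS.vertex_bounds h0 (π.symm j) k 0 hpos
    simp only [hρ, Equiv.apply_symm_apply] at h3
    rw [zero_add] at h1 h2
    rcases h3 with h3 | h3 <;> have h4 := h3 0 hpos <;> rw [add_zero] at h4
    · exact residue_of_ediv_ne hb.1 hb.2 h4 (by omega) h2.symm
    · have := residue_of_ediv_ne (by omega) (by omega) h4 (by omega) h2.symm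
      omega
  · obtain ⟨j, h1, h2⟩ := key 1 (by omega)
    obtain ⟨w, h3⟩ := hw (π.symm j)
    refine ⟨π.symm j, ?_⟩
    have hb := hS.vertex_bounds h0 (π.symm j) k 0 hpos
    simp only [hρ, Equiv.apply_symm_apply] at h3
    have e : 1 * (2 ^ d) ^ k + ((2 ^ d) ^ k - 1) = (1 + 1) * (2 ^ d) ^ k - 1 := by
      rw [add_mul, one_mul]; omega
    rcases h3 with h3 | h3 <;> have h4 := h3 ((2 ^ d) ^ k - 1) (by omega) <;>
      rw [Nat.sub_self, e] at h4
    · exact residue_of_ediv_ne hb.1 hb.2 h4 (by omega) h2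
    · have := residue_of_ediv_ne (by omega) (by omega) h4 (by omega) h2
      omega

end FoldedSystem

/-! ### From binary digits to the coordinates of the start point. -/

lemma eq_of_dyadic_bounds {x c : ℝ} {v : ℕ → ℤ}
    (hx : ∀ k, (v k : ℝ) / 2 ^ k ≤ x ∧ x ≤ ((v k : ℝ) + 1) / 2 ^ k)
    (hc : ∀ k, (v (k + 1) : ℝ) ≤ c * 2 ^ (k + 1) ∧ c * 2 ^ (k + 1) ≤ v (k + 1) + 1) : x = c := by
  have hb : ∀ k : ℕ, |x - c| ≤ (1 / 2 : ℝ) ^ k := by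
    intro k
    have h2 : (0 : ℝ) < 2 ^ (k + 1) := by positivity
    obtain ⟨h3, h4⟩ := hx (k + 1)
    obtain ⟨h5, h6⟩ := hc k
    rw [div_le_iff₀ h2] at h3
    rw [le_div_iff₀ h2] at h4
    have h7 : |x - c| * 2 ^ (k + 1) ≤ 1 := by
      rw [← abs_of_pos h2, ← abs_mul, abs_le]
      constructor <;> nlinarith
    have h8 : |x - c| * 2 ^ k ≤ 1 := by
      have : (0 : ℝ) ≤ |x - c| * 2 ^ k := by positivity
      rw [pow_succ] at h7
      nlinarith
    rw [div_pow, one_pow, le_div_iff₀ (by positivity)]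
    exact h8
  have hlim := tendsto_pow_atTop_nhds_zero_of_lt_one (r := (1 / 2 : ℝ)) (by norm_num) (by norm_num)
  have h0 : |x - c| ≤ 0 := ge_of_tendsto' hlim hb
  exact sub_eq_zero.1 (abs_nonpos_iff.1 h0)

lemma eq_of_const_digits {x : ℝ} {v : ℕ → ℤ} (h0 : v 0 = 0) (hv : ∀ k, v (k + 1) / 2 = v k)
    (hx : ∀ k, (v k : ℝ) / 2 ^ k ≤ x ∧ x ≤ ((v k : ℝ) + 1) / 2 ^ k)
    (hd : ∀ k, ¬ (v (k + 2) % 4 = 1 ∨ v (k + 2) % 4 = 2)) : x = 0 ∨ x = 1 := by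
  have h1 := hv 0
  rw [h0, zero_add] at h1
  rcases (show v 1 = 0 ∨ v 1 = 1 by omega) with h | h
  · have : ∀ k, v (k + 1) = 0 := by
      intro k
      induction k with
      | zero => exact h
      | succ k ih => 
        have h1 : v (k + 2) / 2 = v (k + 1) := hv (k + 1)
        have := hd k
        change v (k + 2) = 0
        omega
    exact Or.inl (eq_of_dyadic_bounds hx fun k => by simp [this])
  · have : ∀ k, v (k + 1) = 2 ^ (k + 1) - 1 := by
      intro k
      induction k with
      | zero => simp [h]
      | succ k ih =>
        have h1 : v (k + 2) / 2 = v (k + 1) := hv (k + 1)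
        have := hd k
        have e : (2 : ℤ) ^ (k + 1) = 2 * 2 ^ k := by ring
        have e' : (2 : ℤ) ^ (k + 1 + 1) = 4 * 2 ^ k := by ring
        change v (k + 2) = _
        omega
    exact Or.inr (eq_of_dyadic_bounds hx fun k => by simp [this])

lemma eq_of_alternating_digits {x : ℝ} {v : ℕ → ℤ} (h0 : v 0 = 0)
    (hv : ∀ k, v (k + 1) / 2 = v k)
    (hx : ∀ k, (v k : ℝ) / 2 ^ k ≤ x ∧ x ≤ ((v k : ℝ) + 1) / 2 ^ k)
    (hd : ∀ k, v (k + 2) % 4 = 1 ∨ v (k + 2) % 4 = 2) : x = 1 / 3 ∨ x = 2 / 3 := by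
  have h1 := hv 0
  rw [h0, zero_add] at h1
  have key : ∀ c : ℤ, (3 * v 1 = c * 2 - 1 ∨ 3 * v 1 = c * 2 - 2) → x = c / 3 := by
    intro c hc
    -- This says that `v (k + 1)` is c 2^(k+1) / 3 rounded down, the quotient not being an integer.
    -- The first digit selects c = 1 or c = 2.
    have : ∀ k, 3 * v (k + 1) = c * 2 ^ (k + 1) - 1 ∨ 3 * v (k + 1) = c * 2 ^ (k + 1) - 2 := by
      intro k
      induction k with
      | zero => simpa using hc
      | succ k ih =>
        have h1 : v (k + 2) / 2 = v (k + 1) := hv (k + 1)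
        have := hd k
        have e : c * (2 : ℤ) ^ (k + 1) = 2 * (c * 2 ^ k) := by ring
        have e' : c * (2 : ℤ) ^ (k + 1 + 1) = 4 * (c * 2 ^ k) := by ring
        change 3 * v (k + 2) = _ ∨ 3 * v (k + 2) = _
        omega
    refine eq_of_dyadic_bounds hx fun k => ?_
    have hk : 3 * (v (k + 1) : ℝ) = c * 2 ^ (k + 1) - 1 ∨
        3 * (v (k + 1) : ℝ) = c * 2 ^ (k + 1) - 2 := by exact_mod_cast this k
    have e : (c : ℝ) / 3 * 2 ^ (k + 1) = c * 2 ^ (k + 1) / 3 := by ring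
    rw [e]
    constructor <;> rcases hk with hk | hk <;> linarith
  rcases (show v 1 = 0 ∨ v 1 = 1 by omega) with h | h
  · left; simpa using key 1 (by omega)
  · right; simpa using key 2 (by omega)

namespace FoldedSystem

variable {d : ℕ} {V : ℕ → ℕ → GridPoint d} {ax : ℕ → ℕ → Fin d}

lemma start_point (hS : FoldedSystem d V ax) (hd : 3 ≤ d) (h0 : ∀ j, V 0 0 j = 0)
    {x : Fin d → ℝ}
    (hx : ∀ k j, (V k 0 j : ℝ) / 2 ^ k ≤ x j ∧ x j ≤ ((V k 0 j : ℝ) + 1) / 2 ^ k) :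
    (∀ j, x j = 0 ∨ x j = 1) ∨
    ∃ y, (x y = 0 ∨ x y = 1) ∧ ∀ j, j ≠ y → x j = 1 / 3 ∨ x j = 2 / 3 := by
  have hv : ∀ j k, V (k + 1) 0 j / 2 = V k 0 j := fun j k => by
    simpa using hS.parent_zero (i := 0) j (by positivity)
  rcases hS.digitDiff_first hd with h | h
  · refine Or.inl fun j => eq_of_const_digits (h0 j) (hv j) (fun k => hx k j) fun k => ?_
    simpa [digitDiff] using h k j
  · right
    choose y hy using h
    -- A coordinate extremal at a fine level is extremal at all coarser ones, so the face found at
    -- level k + 2 determines both `y k` and `y 0`.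
    have hanc : ∀ j r s, (V (r + s) 0 j = 0 ∨ V (r + s) 0 j = 2 ^ (r + s) - 1) →
        V r 0 j = 0 ∨ V r 0 j = 2 ^ r - 1 := by
      intro j r s
      induction s with
      | zero => exact id
      | succ s ih =>
        intro hs
        apply ih
        have h1 := hv j (r + s)
        have e : (2 : ℤ) ^ (r + (s + 1)) = 2 * 2 ^ (r + s) := by ring
        rw [← add_assoc] at hs e
        omega
    have hface : ∀ r j, (V (r + 2) 0 j = 0 ∨ V (r + 2) 0 j = 2 ^ (r + 2) - 1) → y r = j := by
      intro r j hj
      have h1 := hy r j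
      have e : (2 : ℤ) ^ (r + 2) = 4 * 2 ^ r := by ring
      have h2 : digitDiff V (r + 2) 0 j = false := by
        rw [digitDiff, decide_eq_false_iff_not]
        omega
      rw [h2] at h1
      simp only [ne_eq, decide_not, Bool.false_eq, Bool.not_eq_false', decide_eq_true_eq] at h1
      exact h1.symm
    have hconst : ∀ k, y k = y 0 := by
      intro k
      obtain ⟨j, hj⟩ := hS.exists_face hd h0 (k + 2)
      rw [hface k j hj, hface 0 j (hanc j 2 k (by rwa [add_comm]))]
    refine ⟨y 0, eq_of_const_digits (h0 _) (hv _) (fun k => hx k _) fun k => ?_, fun j hj =>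
      eq_of_alternating_digits (h0 j) (hv j) (fun k => hx k j) fun k => ?_⟩
    · have := hy k (y 0)
      rw [hconst k] at this
      simpa [digitDiff] using this
    · have := hy k j
      rw [hconst k] at this
      simpa [digitDiff, hj] using this

end FoldedSystem

lemma exists_symmetry_of_start {d : ℕ} (hd : 3 ≤ d) {x : Fin d → unitInterval}
    (hx : (∀ j, (x j : ℝ) = 0 ∨ (x j : ℝ) = 1) ∨
      ∃ y, ((x y : ℝ) = 0 ∨ (x y : ℝ) = 1) ∧ ∀ j, j ≠ y → (x j : ℝ) = 1 / 3 ∨ (x j : ℝ) = 2 / 3) :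
    ∃ g : CubeSymmetry d, (∀ j : Fin d, (g.apply x j : ℝ) = 0) ∨
      ∀ j : Fin d, (g.apply x j : ℝ) = if (j : ℕ) + 1 = d then 0 else 1 / 3 := by
  classical
  rcases hx with h | ⟨y, hy, h⟩
  · refine ⟨⟨Equiv.refl _, fun j => decide ((x j : ℝ) = 1)⟩, Or.inl fun j => ?_⟩
    rcases h j with h | h <;> simp [CubeSymmetry.apply, h]
  · set l : Fin d := ⟨d - 1, by omega⟩
    refine ⟨⟨Equiv.swap y l, fun j => decide (1 / 2 < (x (Equiv.swap y l j) : ℝ))⟩,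
      Or.inr fun j => ?_⟩
    have hl : (j : ℕ) + 1 = d ↔ j = l := by
      rw [Fin.ext_iff]; simp only [l]; omega
    by_cases hj : j = l
    · rw [if_pos (hl.2 hj), hj]
      rcases hy with hy | hy <;> norm_num [CubeSymmetry.apply, hy]
    · rw [if_neg (hl.not.2 hj)]
      have hne : Equiv.swap y l j ≠ y := by
        rw [ne_eq, Equiv.swap_apply_eq_iff, Equiv.swap_apply_left]
        exact hj
      rcases h _ hne with h | h <;> norm_num [CubeSymmetry.apply, h]

/-! ### Indexing lists, Gray codes and their isometric images. -/

lemma List.length_flatten_of_length_eq {α : Type*} {L : ℕ} {Cs : List (List α)}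
    (h : ∀ C ∈ Cs, C.length = L) : Cs.flatten.length = Cs.length * L := by
  induction Cs with
  | nil => simp
  | cons C Cs ih =>
    rw [List.flatten_cons, List.length_append, ih fun C hC => h C (List.mem_cons_of_mem _ hC),
      h C List.mem_cons_self, List.length_cons]
    ring

lemma List.getD_flatten_of_length_eq {α : Type*} {L : ℕ} (x : α) {m : ℕ} (hm : m < L) :
    ∀ {Cs : List (List α)}, (∀ C ∈ Cs, C.length = L) → ∀ {i : ℕ} (hi : i < Cs.length),
      Cs.flatten.getD (i * L + m) x = (Cs[i]).getD m x := by
  intro Cs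
  induction Cs with
  | nil => intro _ i hi; simp at hi
  | cons C Cs ih =>
    intro h i hi
    have hC := h C List.mem_cons_self
    cases i with
    | zero =>
      rw [List.flatten_cons, zero_mul, zero_add, List.getD_append _ _ _ _ (by omega)]
      rfl
    | succ i =>
      rw [List.flatten_cons, List.getD_append_right _ _ _ _ (by rw [hC, add_mul]; omega),
        List.getElem_cons_succ, ← ih (fun C hC => h C (List.mem_cons_of_mem _ hC)), hC]
      congr 1
      rw [add_mul]
      omega

lemma IsGridEdge.exists_axis {d : ℕ} {v w : GridPoint d} (h : IsGridEdge v w) :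
    ∃ j, (w j = v j + 1 ∨ w j = v j - 1) ∧ ∀ j', j' ≠ j → w j' = v j' := by
  classical
  unfold IsGridEdge at h
  have hex : ∃ j, w j ≠ v j := by
    by_contra! hcon
    simp [hcon] at h
  obtain ⟨j, hj⟩ := hex
  have hsplit := Finset.add_sum_erase Finset.univ (fun j => (w j - v j) ^ 2) (Finset.mem_univ j)
  simp only [h] at hsplit
  have hnn : ∀ j' ∈ Finset.univ.erase j, 0 ≤ (w j' - v j') ^ 2 := fun j' _ => sq_nonneg _
  have hsum := Finset.sum_nonneg hnn
  have h1 : 0 < (w j - v j) ^ 2 := by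
    have : w j - v j ≠ 0 := sub_ne_zero.2 hj
    positivity
  have h2 : (w j - v j) ^ 2 = 1 := by omega
  refine ⟨j, ?_, fun j' hj' => ?_⟩
  · rw [pow_two, mul_self_eq_one_iff] at h2
    omega
  · have h0 : ∑ x ∈ Finset.univ.erase j, (w x - v x) ^ 2 = 0 := by omega
    have := (Finset.sum_eq_zero_iff_of_nonneg hnn).1 h0 j' (by simp [hj'])
    have := pow_eq_zero_iff (two_ne_zero) |>.1 this
    omega

lemma IsKCurveAt.length_eq {d k : ℕ} {c : GridPoint d} {C : List (GridPoint d)}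
    (h : IsKCurveAt k c C) : C.length = (2 ^ d) ^ k := by
  classical
  have : C.toFinset = Fintype.piFinset fun j => Finset.Ico (c j) (c j + 2 ^ k) := by
    ext v
    rw [List.mem_toFinset, h.2, Fintype.mem_piFinset]
    simp
  rw [← List.toFinset_card_of_nodup h.1.2.1, this, Fintype.card_piFinset]
  have h2 : ((2 : ℤ) ^ k).toNat = 2 ^ k := by exact_mod_cast Int.toNat_natCast (2 ^ k)
  simp [h2, ← pow_mul, mul_comm]

lemma length_grayCode (n : ℕ) : (grayCode n).length = 2 ^ n - 1 := by
  induction n with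
  | zero => rfl
  | succ n ih =>
    have : 0 < 2 ^ n := by positivity
    simp only [grayCode, List.length_append, List.length_map, List.length_reverse, ih,
      List.length_singleton, pow_succ]
    omega

/-- The axes of the Gray code form the ruler sequence. The second half mirrors the first, and
replacing m by 2^(D+1) - m keeps the power of two in m. -/
lemma natAbs_grayCode (D : ℕ) : ∀ n q, 2 ^ n * (2 * q + 1) < 2 ^ D →
    ((grayCode D).getD (2 ^ n * (2 * q + 1) - 1) 0).natAbs = n + 1 := by
  induction D with
  | zero =>
    intro n q h
    have : 0 < 2 ^ n * (2 * q + 1) := by positivity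
    rw [pow_zero] at h
    omega
  | succ D ih =>
    intro n q h
    have hL := length_grayCode D
    have hm : 0 < 2 ^ n * (2 * q + 1) := by positivity
    have hD : 0 < 2 ^ D := by positivity
    have e : 2 ^ (D + 1) = 2 * 2 ^ D := by ring
    rw [grayCode, List.append_assoc]
    rcases lt_trichotomy (2 ^ n * (2 * q + 1)) (2 ^ D) with hlt | heq | hgt
    · rw [List.getD_append _ _ _ _ (by omega)]
      exact ih n q hlt
    · have hn : n = D := by
        rcases lt_trichotomy n D with hn | hn | hn
        · obtain ⟨r, rfl⟩ := Nat.exists_eq_add_of_lt hn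
          rw [show 2 ^ (n + r + 1) = 2 ^ n * (2 * 2 ^ r) by ring] at heq
          have := Nat.eq_of_mul_eq_mul_left (by positivity) heq
          omega
        · exact hn
        · have := Nat.pow_lt_pow_right (a := 2) (by norm_num) hn
          have := Nat.le_mul_of_pos_right (2 ^ n) (show 0 < 2 * q + 1 by omega)
          omega
      rw [List.getD_append_right _ _ _ _ (by omega), heq, hL, Nat.sub_self, hn]
      simp only [List.singleton_append, List.getD_cons_zero]
      omega
    · have hn : n < D + 1 := by
        by_contra hn
        have := Nat.pow_le_pow_right (n := 2) (by norm_num) (show D + 1 ≤ n by omega)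
        have := Nat.le_mul_of_pos_right (2 ^ n) (show 0 < 2 * q + 1 by omega)
        omega
      obtain ⟨q', hq'⟩ := two_pow_sub_two_pow_mul_odd hn h
      have hi := ih n q' (by omega)
      rw [List.getD_append_right _ _ _ _ (by omega), hL,
        List.getD_append_right _ _ _ _ (by simp; omega), List.length_singleton,
        List.getD_eq_getElem _ _ (by simp; omega), List.getElem_map, List.getElem_reverse,
        Int.natAbs_neg]
      rw [List.getD_eq_getElem _ _ (by omega)] at hi
      rw [← hi]
      congr 2
      omega

lemma length_grayCurve (d : ℕ) : (grayCurve d).length = 2 ^ d := by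
  have : 0 < 2 ^ d := by positivity
  rw [grayCurve, List.length_scanl, length_grayCode]
  omega

lemma grayCurve_step {d n q : ℕ} (hn : n < d) (h : 2 ^ n * (2 * q + 1) < 2 ^ d) :
    (grayCurve d).getD (2 ^ n * (2 * q + 1)) 0 ⟨n, hn⟩ ≠
      (grayCurve d).getD (2 ^ n * (2 * q + 1) - 1) 0 ⟨n, hn⟩ := by
  have hL := length_grayCurve d
  have hG := length_grayCode d
  have hm : 0 < 2 ^ n * (2 * q + 1) := by positivity
  have hg := natAbs_grayCode d n q h
  rw [grayCurve] at hL ⊢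
  generalize 2 ^ n * (2 * q + 1) = m at *
  obtain ⟨m, rfl⟩ := Nat.exists_eq_add_of_lt hm
  simp only [zero_add, Nat.add_sub_cancel] at *
  rw [List.getD_eq_getElem _ _ (by omega), List.getD_eq_getElem _ _ (by omega)]
  rw [List.getD_eq_getElem _ _ (by omega)] at hg
  simp only [List.getElem_succ_scanl, Pi.add_apply]
  rw [ne_eq, add_eq_left, dirStep, if_pos hg, Int.sign_eq_zero_iff_zero]
  omega

lemma IsIsometricImage.length_eq {d : ℕ} {C C' : List (GridPoint d)}
    (h : IsIsometricImage C C') : C'.length = C.length := by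
  obtain ⟨g, rfl | rfl⟩ := h <;> simp

/-- Indices of the vertices of an isometric image. -/
lemma IsIsometricImage.exists_getD {d : ℕ} {C C' : List (GridPoint d)}
    (h : IsIsometricImage C C') : ∃ (g : GridIsometry d) (ρ : ℕ → ℕ),
      ((∀ m, ρ m = m) ∨ ∀ m, ρ m = C.length - 1 - m) ∧
      ∀ m < C.length, C'.getD m 0 = g.apply (C.getD (ρ m) 0) := by
  obtain ⟨g, rfl | rfl⟩ := h
  · refine ⟨g, fun m => m, Or.inl fun m => rfl, fun m hm => ?_⟩
    rw [List.getD_eq_getElem _ _ (by simpa using hm), List.getD_eq_getElem _ _ hm,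
      List.getElem_map]
  · refine ⟨g, fun m => C.length - 1 - m, Or.inr fun m => rfl, fun m hm => ?_⟩
    rw [List.getD_eq_getElem _ _ (by simpa using hm), List.getD_eq_getElem _ _ (by simp only; omega),
      List.getElem_reverse, List.getElem_map]
    simp

lemma GridIsometry.apply_symm_ne {d : ℕ} (g : GridIsometry d) {v w : GridPoint d} {j : Fin d}
    (h : v j ≠ w j) : g.apply v (g.perm.symm j) ≠ g.apply w (g.perm.symm j) := by
  simpa [GridIsometry.apply] using h

lemma exists_axes_of_isometricImage_grayCurve {d : ℕ} {C : List (GridPoint d)}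
    (h : IsIsometricImage (grayCurve d) C) :
    ∃ a : Fin d → Fin d, Function.Injective a ∧ ∀ n (hn : n < d) q, 2 ^ n * (2 * q + 1) < 2 ^ d →
      C.getD (2 ^ n * (2 * q + 1)) 0 (a ⟨n, hn⟩) ≠
        C.getD (2 ^ n * (2 * q + 1) - 1) 0 (a ⟨n, hn⟩) := by
  have hL := length_grayCurve d
  obtain ⟨g, ρ, hρ, hg⟩ := h.exists_getD
  rw [hL] at hg hρ
  refine ⟨g.perm.symm, g.perm.symm.injective, fun n hn q hq => ?_⟩
  have hm : 0 < 2 ^ n * (2 * q + 1) := by positivity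
  rw [hg _ hq, hg _ (by omega)]
  apply g.apply_symm_ne
  rcases hρ with hρ | hρ <;> rw [hρ, hρ]
  · exact grayCurve_step hn hq
  · obtain ⟨q', hq'⟩ := two_pow_sub_two_pow_mul_odd hn hq
    rw [show 2 ^ d - 1 - (2 ^ n * (2 * q + 1) - 1) = 2 ^ d - 2 ^ n * (2 * q + 1) by omega,
      show 2 ^ d - 1 - 2 ^ n * (2 * q + 1) = 2 ^ d - 2 ^ n * (2 * q + 1) - 1 by omega, hq']
    exact (grayCurve_step hn (by omega)).symm

/-! ### The approximating curves form a folded system. -/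

namespace SpaceFillingCurve

variable {d : ℕ} (f : SpaceFillingCurve d)

/-- The vertex with index `i` of the `k`-th approximating curve. -/
def vertex (k i : ℕ) : GridPoint d := (f.approx k).getD i 0

lemma length_approx (k : ℕ) : (f.approx k).length = (2 ^ d) ^ k := (f.isKCurve k).length_eq

lemma vertex_edge {k m : ℕ} (h0 : 0 < m) (hm : m < (2 ^ d) ^ k) :
    IsGridEdge (f.vertex k (m - 1)) (f.vertex k m) := by
  have hL := f.length_approx k
  obtain ⟨m, rfl⟩ := Nat.exists_eq_add_of_lt h0
  have := (f.isKCurve k).1.2.2.getElem m (by omega)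
  simp only [zero_add, Nat.add_sub_cancel] at *
  rwa [vertex, vertex, List.getD_eq_getElem _ _ (by omega), List.getD_eq_getElem _ _ (by omega)]

lemma vertex_parent (k i m : ℕ) (j : Fin d) (hi : i < (2 ^ d) ^ k) (hm : m < 2 ^ d) :
    f.vertex (k + 1) (i * 2 ^ d + m) j / 2 = f.vertex k i j := by
  obtain ⟨Cs, h1, h2, -⟩ := f.inflation k
  have hlen : Cs.length = (2 ^ d) ^ k := by rw [← h1.length_eq, f.length_approx]
  rw [List.forall₂_iff_get] at h1
  have hC : ∀ C ∈ Cs, C.length = 2 ^ d := by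
    intro C hC
    obtain ⟨i, hi, rfl⟩ := List.getElem_of_mem hC
    have := (h1.2 i (by rw [h1.1]; exact hi) hi).length_eq
    simpa using this
  have hi' : i < Cs.length := by omega
  have hk := h1.2 i (by rw [h1.1]; exact hi') hi'
  rw [vertex, h2, List.getD_flatten_of_length_eq 0 hm hC hi', vertex,
    List.getD_eq_getElem _ _ (by rw [hC _ (List.getElem_mem _)]; exact hm),
    List.getD_eq_getElem _ _ (by rw [h1.1]; exact hi')]
  have hmem : (Cs[i])[m]'(by rw [hC _ (List.getElem_mem _)]; exact hm) ∈ Cs[i] :=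
    List.getElem_mem _
  have := (hk.2 _).1 hmem j
  simp only [List.get_eq_getElem, Pi.smul_apply, nsmul_eq_mul, Nat.cast_ofNat, pow_one] at this
  omega

lemma mem_approx_iff (k : ℕ) (v : GridPoint d) :
    v ∈ f.approx k ↔ ∃ m < (2 ^ d) ^ k, f.vertex k m = v := by
  rw [List.mem_iff_getElem]
  have hL := f.length_approx k
  constructor
  · rintro ⟨m, hm, h⟩
    exact ⟨m, by omega, by rw [vertex, List.getD_eq_getElem _ _ hm, h]⟩
  · rintro ⟨m, hm, h⟩
    exact ⟨m, by omega, by rw [← h, vertex, List.getD_eq_getElem]⟩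

lemma exists_vertex_coord (k : ℕ) (j : Fin d) {c : ℤ} (h0 : 0 ≤ c) (h1 : c < 2 ^ k) :
    ∃ m < (2 ^ d) ^ k, f.vertex k m j = c := by
  obtain ⟨m, hm, h⟩ := (f.mem_approx_iff k fun _ => c).1 (by
    rw [(f.isKCurve k).2]; simp [h0, h1])
  exact ⟨m, hm, congrFun h j⟩

variable {f}

lemma WellFolded.exists_axes (hwf : f.WellFolded) (hd : 0 < d) {k i : ℕ} (hi : i < (2 ^ d) ^ k) :
    ∃ a : Fin d → Fin d, Function.Injective a ∧ ∀ n (hn : n < d) q, 2 ^ n * (2 * q + 1) < 2 ^ d →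
      f.vertex (k + 1) (i * 2 ^ d + 2 ^ n * (2 * q + 1)) (a ⟨n, hn⟩) ≠
        f.vertex (k + 1) (i * 2 ^ d + 2 ^ n * (2 * q + 1) - 1) (a ⟨n, hn⟩) := by
  have hL := f.length_approx (k + 1)
  have hw := hwf (k + 1)
  have h1 : 1 < (2 ^ d) ^ (k + 1) :=
    Nat.one_lt_pow (by omega) (Nat.one_lt_two_pow (by omega))
  generalize hB : f.approx (k + 1) = B at hw hL
  cases hw with
  | single v => simp at hL; omega
  | inflate A Cs B _ hinf himg =>
    -- The curve `A` need not be identified with `f.approx k`: the lengths alone align the children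
    -- with blocks of indices.
    have hC : ∀ C ∈ Cs, C.length = 2 ^ d := fun C hC => by
      rw [(himg C hC).length_eq, length_grayCurve]
    have hlen : Cs.length = (2 ^ d) ^ k := by
      rw [hinf.2.1, List.length_flatten_of_length_eq hC, pow_succ] at hL
      exact Nat.eq_of_mul_eq_mul_right (by positivity) hL
    have hv : ∀ m < 2 ^ d, f.vertex (k + 1) (i * 2 ^ d + m) =
        (Cs[i]'(by omega)).getD m 0 := fun m hm => by
      rw [vertex, hB, hinf.2.1, List.getD_flatten_of_length_eq 0 hm hC]
    obtain ⟨a, ha, h⟩ := exists_axes_of_isometricImage_grayCurve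
      (himg (Cs[i]'(by omega)) (List.getElem_mem _))
    refine ⟨a, ha, fun n hn q hq => ?_⟩
    have hm : 0 < 2 ^ n * (2 * q + 1) := by positivity
    rw [Nat.add_sub_assoc hm, hv _ hq, hv _ (by omega)]
    exact h n hn q hq

lemma SelfSimilar.exists_isometry (hss : f.SelfSimilar) {k t : ℕ} (ht : t < 2 ^ d) :
    ∃ (g : GridIsometry d) (ρ : ℕ → ℕ),
      ((∀ m, ρ m = m) ∨ ∀ m, ρ m = (2 ^ d) ^ k - 1 - m) ∧
      ∀ m < (2 ^ d) ^ k,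
        f.vertex (k + 1) (t * (2 ^ d) ^ k + m) = g.apply (f.vertex k (ρ m)) := by
  obtain ⟨Bs, hlen, himg, h⟩ := hss k
  have hC : ∀ C ∈ Bs, C.length = (2 ^ d) ^ k := fun C hC => by
    rw [(himg C hC).length_eq, f.length_approx]
  obtain ⟨g, ρ, hρ, hg⟩ := (himg (Bs[t]'(by omega)) (List.getElem_mem _)).exists_getD
  rw [f.length_approx] at hρ hg
  refine ⟨g, ρ, hρ, fun m hm => ?_⟩
  rw [vertex, h, List.getD_flatten_of_length_eq 0 hm hC (by omega), hg m hm, vertex]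

lemma SelfSimilar.exists_perm (hss : f.SelfSimilar) {k t : ℕ} (ht : t < 2 ^ d) :
    ∃ (π : Equiv.Perm (Fin d)) (ρ : ℕ → ℕ),
    ((∀ m, ρ m = m) ∨ ∀ m, ρ m = (2 ^ d) ^ k - 1 - m) ∧
    ∀ j, ∃ w : ℤ,
      (∀ m < (2 ^ d) ^ k,
        f.vertex (k + 1) (t * (2 ^ d) ^ k + m) (π j) = 2 ^ k * w + f.vertex k (ρ m) j) ∨
      (∀ m < (2 ^ d) ^ k, f.vertex (k + 1) (t * (2 ^ d) ^ k + m) (π j) =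
        2 ^ k * w + (2 ^ k - 1 - f.vertex k (ρ m) j)) := by
  obtain ⟨g, ρ, hρ, hg⟩ := hss.exists_isometry (k := k) ht
  -- By inflation, copy `t` stays in the cube of width 2^k over vertex `t` of A_1. Points with the
  -- extreme coordinates 0 and 2^k - 1 then leave only one possible shift.
  refine ⟨g.perm.symm, ρ, hρ, fun j => ⟨f.vertex 1 t (g.perm.symm j), ?_⟩⟩
  have h2 : (0 : ℤ) < 2 ^ k := by positivity
  have hinv : ∀ m < (2 ^ d) ^ k, ∃ m' < (2 ^ d) ^ k, ρ m' = m := by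
    intro m hm
    rcases hρ with hρ | hρ
    · exact ⟨m, hm, hρ m⟩
    · exact ⟨(2 ^ d) ^ k - 1 - m, by omega, by rw [hρ]; omega⟩
  obtain ⟨a, ha, ha0⟩ := f.exists_vertex_coord k j le_rfl h2
  obtain ⟨b, hb, hb0⟩ := f.exists_vertex_coord k j (c := 2 ^ k - 1) (by omega) (by omega)
  obtain ⟨a', ha', rfl⟩ := hinv a ha
  obtain ⟨b', hb', rfl⟩ := hinv b hb
  have hbox : ∀ m < (2 ^ d) ^ k,
      2 ^ k * f.vertex 1 t (g.perm.symm j) ≤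
        f.vertex (k + 1) (t * (2 ^ d) ^ k + m) (g.perm.symm j) ∧
      f.vertex (k + 1) (t * (2 ^ d) ^ k + m) (g.perm.symm j) <
        2 ^ k * f.vertex 1 t (g.perm.symm j) + 2 ^ k := by
    intro m hm
    have := FoldedSystem.ancestor f.vertex_parent ht (g.perm.symm j) k m hm
    rw [← this]
    exact ⟨Int.mul_ediv_self_le h2.ne', Int.lt_mul_ediv_self_add h2⟩
  have hval : ∀ m < (2 ^ d) ^ k, f.vertex (k + 1) (t * (2 ^ d) ^ k + m) (g.perm.symm j) =
      (g.sign (g.perm.symm j) : ℤ) * f.vertex k (ρ m) j + g.shift (g.perm.symm j) := by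
    intro m hm
    rw [hg m hm]
    simp [GridIsometry.apply]
  have h1 := hbox a' ha'
  have h2 := hbox b' hb'
  rw [hval a' ha', ha0] at h1
  rw [hval b' hb', hb0] at h2
  rcases Int.units_eq_one_or (g.sign (g.perm.symm j)) with hs | hs
  · left
    intro m hm
    rw [hval m hm]
    rw [hs] at h1 h2 ⊢
    simp only [Units.val_one, one_mul] at h1 h2 ⊢
    omega
  · right
    intro m hm
    rw [hval m hm]
    rw [hs] at h1 h2 ⊢
    simp only [Units.val_neg, Units.val_one, neg_mul, one_mul] at h1 h2 ⊢
    omega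

lemma axesOf_window {k s L : ℕ} {ax : ℕ → Fin d} (hs : s + L < (2 ^ d) ^ k)
    (hax : ∀ m, 0 < m → m < (2 ^ d) ^ k → f.vertex k m (ax m) ≠ f.vertex k (m - 1) (ax m) ∧
      ∀ j, j ≠ ax m → f.vertex k m j = f.vertex k (m - 1) j) :
    axesOf (((f.approx k).drop s).take (L + 1)) = ((Finset.Ioc s (s + L)).image ax : Set (Fin d)) := by
  have hlen := f.length_approx k
  ext j
  simp only [axesOf, Set.mem_ofPred_eq, Finset.coe_image, Set.mem_image, Finset.coe_Ioc,
    Set.mem_Ioc]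
  constructor
  · rintro ⟨v, w, hvw, hj⟩
    rw [List.infix_iff_getElem?] at hvw
    obtain ⟨r, hr, h⟩ := hvw
    simp only [List.length_cons, List.length_nil, List.length_take, List.length_drop] at hr
    have hv := h 0 (by simp)
    have hw := h 1 (by simp)
    rw [List.getElem?_take_of_lt (by omega), List.getElem?_drop] at hv hw
    simp only [List.getElem_cons_zero, List.getElem_cons_succ] at hv hw
    have hv' : f.vertex k (s + 1 + r - 1) = v := by
      rw [vertex, List.getD_eq_getElem?_getD, show s + 1 + r - 1 = s + (0 + r) by omega, hv]; rfl
    have hw' : f.vertex k (s + 1 + r) = w := by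
      rw [vertex, List.getD_eq_getElem?_getD, show s + 1 + r = s + (1 + r) by omega, hw]; rfl
    refine ⟨s + 1 + r, by omega, ?_⟩
    by_contra hne
    have := (hax (s + 1 + r) (by omega) (by omega)).2 j (Ne.symm hne)
    rw [hv', hw'] at this
    exact hj this.symm
  · rintro ⟨m, hm, rfl⟩
    refine ⟨f.vertex k (m - 1), f.vertex k m, ?_, (hax m (by omega) (by omega)).1.symm⟩
    rw [List.infix_iff_getElem?]
    refine ⟨m - 1 - s, by simp; omega, fun i hi => ?_⟩
    have hi' : i = 0 ∨ i = 1 := by simp at hi; omega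
    rw [List.getElem?_take_of_lt (by omega), List.getElem?_drop]
    rcases hi' with rfl | rfl
    · rw [show s + (0 + (m - 1 - s)) = m - 1 by omega, List.getElem?_eq_getElem (by omega)]
      exact congrArg some (List.getD_eq_getElem _ _ _).symm
    · rw [show s + (1 + (m - 1 - s)) = m by omega, List.getElem?_eq_getElem (by omega)]
      exact congrArg some (List.getD_eq_getElem _ _ _).symm

theorem exists_foldedSystem (hd : 3 ≤ d) (hss : f.SelfSimilar) (hho : f.Hyperorthogonal)
    (hwf : f.WellFolded) : ∃ ax, FoldedSystem d f.vertex ax := by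
  have hex : ∀ k m, ∃ j : Fin d, 0 < m → m < (2 ^ d) ^ k →
      (f.vertex k m j = f.vertex k (m - 1) j + 1 ∨ f.vertex k m j = f.vertex k (m - 1) j - 1) ∧
      ∀ j', j' ≠ j → f.vertex k m j' = f.vertex k (m - 1) j' := by
    intro k m
    by_cases h : 0 < m ∧ m < (2 ^ d) ^ k
    · obtain ⟨j, hj⟩ := (f.vertex_edge h.1 h.2).exists_axis
      exact ⟨j, fun _ _ => hj⟩
    -- Outside the range of edge indices the axis is a dummy value.
    · exact ⟨⟨0, by omega⟩, fun h1 h2 => absurd ⟨h1, h2⟩ h⟩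
  choose ax hax using hex
  have hne : ∀ k m, 0 < m → m < (2 ^ d) ^ k →
      f.vertex k m (ax k m) ≠ f.vertex k (m - 1) (ax k m) := by
    intro k m h0 hm
    rcases (hax k m h0 hm).1 with h | h <;> omega
  have huniq : ∀ k m j, 0 < m → m < (2 ^ d) ^ k → f.vertex k m j ≠ f.vertex k (m - 1) j →
      ax k m = j := by
    intro k m j h0 hm h
    by_contra hcon
    exact h ((hax k m h0 hm).2 j (Ne.symm hcon))
  have hgray : ∀ k i, i < (2 ^ d) ^ k → ∃ a : Fin d → Fin d, Function.Injective a ∧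
      ∀ n (hn : n < d) q, 2 ^ n * (2 * q + 1) < 2 ^ d →
        ax (k + 1) (i * 2 ^ d + 2 ^ n * (2 * q + 1)) = a ⟨n, hn⟩ := by
    intro k i hi
    obtain ⟨a, ha, h⟩ := hwf.exists_axes (by omega) hi
    refine ⟨a, ha, fun n hn q hq => huniq _ _ _ ?_ (FoldedSystem.mul_add_lt hi hq) (h n hn q hq)⟩
    positivity
  refine ⟨ax, fun k m h0 hm => (hax k m h0 hm).1, fun k m j h0 hm => (hax k m h0 hm).2 j,
    f.vertex_parent, fun k i n q hi hq => ?_, fun k i n n' hi hn hn' h => ?_,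
    fun k n s hn hs => ?_, fun k t ht => hss.exists_perm ht⟩
  · obtain ⟨a, ha, h⟩ := hgray k i hi
    have hle : 2 ^ n * 1 ≤ 2 ^ n * (2 * q + 1) := Nat.mul_le_mul_left _ (by omega)
    have hn : n < d := (Nat.pow_lt_pow_iff_right (a := 2) (by norm_num)).1 (by omega)
    have h0 := h n hn 0 (by omega)
    rw [mul_zero, zero_add, mul_one] at h0
    rw [h n hn q hq, h0]
  · obtain ⟨a, ha, hA⟩ := hgray k i hi
    have h1 := hA n hn 0 (by simpa using FoldedSystem.two_pow_lt hn)
    have h2 := hA n' hn' 0 (by simpa using FoldedSystem.two_pow_lt hn')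
    rw [mul_zero, zero_add, mul_one] at h1 h2
    rw [h1, h2] at h
    simpa using ha h
  · have hlen := f.length_approx k
    have := hho k n hn (((f.approx k).drop s).take (2 ^ n + 1))
      ((List.take_prefix _ _).isInfix.trans (List.drop_suffix _ _).isInfix)
      (by simp; omega)
    rwa [axesOf_window (ax := ax k) hs fun m h0 hm => ⟨hne k m h0 hm, (hax k m h0 hm).2⟩,
      Set.ncard_coe_finset] at this

lemma start_bounds (k : ℕ) (j : Fin d) :
    (f.vertex k 0 j : ℝ) / 2 ^ k ≤ f.toFun 0 j ∧
      (f.toFun 0 j : ℝ) ≤ ((f.vertex k 0 j : ℝ) + 1) / 2 ^ k := by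
  have hlen := f.length_approx k
  have hpos : 0 < (2 ^ d) ^ k := by positivity
  have h := f.visits k 0 (f.vertex k 0) (by
    rw [vertex, List.getD_eq_getElem _ _ (by omega), List.getElem?_eq_getElem (by omega)])
  have h0 : f.toFun 0 ∈ f.toFun '' {t | ((0 : ℕ) : ℝ) / 2 ^ (d * k) ≤ (t : ℝ) ∧
      (t : ℝ) ≤ (((0 : ℕ) : ℝ) + 1) / 2 ^ (d * k)} :=
    ⟨0, ⟨by simp, by simp⟩, rfl⟩
  rw [h] at h0
  exact h0 j

end SpaceFillingCurve

theorem mainTheorem5 (d : ℕ) (hd : 3 ≤ d) (f : SpaceFillingCurve d)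
    (hss : f.SelfSimilar) (hho : f.Hyperorthogonal) (hwf : f.WellFolded) :
    ∃ h : unitInterval → Fin d → unitInterval, EqualModuloIsometry f.toFun h ∧
      ((∀ j : Fin d, (h 0 j : ℝ) = 0) ∨
        (∀ j : Fin d, (h 0 j : ℝ) = if (j : ℕ) + 1 = d then 0 else 1 / 3)) := by
  obtain ⟨ax, hS⟩ := SpaceFillingCurve.exists_foldedSystem hd hss hho hwf
  have h0 : ∀ j, f.vertex 0 0 j = 0 := by
    intro j
    have := ((f.isKCurve 0).2 (f.vertex 0 0)).1 ((f.mem_approx_iff 0 _).2 ⟨0, by simp, rfl⟩) j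
    simp only [Pi.zero_apply, pow_zero] at this
    omega
  obtain ⟨g, hg⟩ := exists_symmetry_of_start hd
    (hS.start_point hd h0 fun k j => SpaceFillingCurve.start_bounds k j)
  exact ⟨fun t => g.apply (f.toFun t), ⟨g, Or.inl fun _ => rfl⟩, hg⟩
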